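/- **Setting.** Let $n\ge 1$ and let $\mu$ be a Borel measure on $\mathbf R^n$ with $0<\mu(B)<\infty$ for all balls $B$ and $\mu(2B)\le C\mu(B)$ for all balls $B$; if $C$ is the smallest such constant, $\nu:=\log_2 C$ is the doubling dimension. Write $|E|=\mu(E)$, $\langle f\rangle_{p,E}:=\|f\chi_E\|_{L^p(|E|^{-1}d\mu)}$, $\langle f,g\rangle:=\int fg\,d\mu$ and $p':=p/(p-1)$, with $1'=\infty$, $\infty'=1$. For $\alpha\in\{0,\frac13,\frac23\}^n$ let $\mathscr D^\alpha:=\{2^{-k}([0,1)^n+m+(-1)^k\alpha):k\in\mathbf Z,\,m\in\mathbf Z^n\}$ and let $\mathscr D:=\bigcup_\alpha\mathscr D^\alpha$. A collection $\mathscr S\subseteq\mathscr D$ is $\eta$-sparse ($0<\eta\le1$) if for each $\alpha$ there are pairwise disjoint measurable sets $(E_Q)_{Q\in\mathscr S\cap\mathscr D^\alpha}$ with $E_Q\subseteq Q$ and $|Q|\le\eta^{-1}|E_Q|$. **Weights.** A weight is a measurable function $w:\mathbf R^n\to(0,\infty)$; it is identified with the measure $w\,d\mu$. Put $$[w]_{A_1}:=\sup_{Q\in\mathscr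 D}\langle w\rangle_{1,Q}\big(\operatorname*{ess\,inf}_Q w\big)^{-1},\qquad [w]_{A_\infty}:=\sup_{B}\frac1{w(B)}\int_B M(w\chi_B)\,d\mu,\qquad [w]_{RH_s}:=\sup_{Q\in\mathscr D}\langle w\rangle_{s,Q}\langle w\rangle_{1,Q}^{-1}\quad(1<s\le\infty),$$ where $B$ ranges over all balls and $M$ is the uncentered maximal operator over balls. The classes $A_1$, $A_\infty$ (for locally integrable $w$) and $RH_s$ (for locally integrable $w$) consist of the weights for which the respective constant is finite; $RH_1:=A_\infty$ and $[w]_{RH_1}:=1$. **Operators.** Fix a linear space $\mathcal D$ of (real- or complex-valued) test functions that is contained and dense in $L^q(w)$ for all $1\le q<\infty$ and all $w\in A_\infty$, and that separates functions: if $u$ is measurable, $ug\in L^1(\mu)$ and $\int ug\,d\mu=0$ for all $g\in\mathcal D$, then $u=0$ a.e. (for example $\mathcal D=C_c^\infty(\mathbf R^n)$). For $1\le p_0<q_0\le\infty$ we write $T\in S(p_0,q_0)$ with constants $c_T>0$ and $0<\eta\le1$ if $T$ is a (sub)linear operator from $\mathcal D$ to measurable functions such that $(Tf)g\in L^1(\mu)$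 for all $f,g\in\mathcal D$, and such that for all $f,g\in\mathcal D$ there is an $\eta$-sparse $\mathscr S\subseteq\mathscr D$ with $$|\langle Tf,g\rangle|\le c_T\sum_{Q\in\mathscr S}\langle f\rangle_{p_0,Q}\langle g\rangle_{q_0',Q}|Q|.$$ The norm $\|T\|_{L^p(w)\to L^p(w)}$ is the least $K\in[0,\infty]$ with $\|Tf\|_{L^p(w)}\le K\|f\|_{L^p(w)}$ for all $f$ in the dense subspace $\mathcal D$. **Theorem.** For all $n$, $\nu$, $c_T$, $\eta$ there is a constant $c=c(c_T,\eta,\nu,n)>0$ with the following property. Let $\mu$ have doubling dimension $\nu$, let $1\le p_0<p<q_0\le\infty$, let $T\in S(p_0,q_0)$ with constants $c_T$, $\eta$, and let $w\in A_1\cap RH_{(q_0/p)'}$. Then $$\|T\|_{L^p(w)\to L^p(w)}\le c\,c_p\,\big[w^{(q_0/p)'}\big]_{A_\infty}^{\frac1{p'}}\big[w^{(q_0/p)'}\big]_{A_1}^{\frac1{p(q_0/p)'}},\qquad c_p=\Big[\Big(\frac{p'}{q_0'}\Big)'\Big]^{\frac1{q_0'}}\Big[\Big(\frac{p_0'}{p'}\Big)'\Big(\frac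 p{p_0}\Big)'\Big]^{\frac1{p_0}}.$$ In particular, $$\|T\|_{L^p(w)\to L^p(w)}\le c\,c_p\,\big[w^{(q_0/p)'}\big]_{A_1}^{\frac1{q_0'}},\qquad c_p\,\big[w^{(q_0/p)'}\big]_{A_1}^{\frac1{q_0'}}\le c_p\big([w]_{A_1}[w]_{RH_{(q_0/p)'}}\big)^{\frac{q_0-1}{q_0-p}},$$ where the last exponent is read as $1$ if $q_0=\infty$. -/

import Mathlib

open MeasureTheory Set
open scoped ENNReal

noncomputable section

namespace SparseWeights

/-! ### Doubling measures on Euclidean space -/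

/-- Euclidean `n`-space. -/
abbrev Rn (n : ℕ) : Type := EuclideanSpace ℝ (Fin n)

/-- `C` is an admissible constant in the doubling inequality `μ(2B) ≤ C μ(B)`. -/
def IsDoublingConst {n : ℕ} (μ : Measure (Rn n)) (C : ℝ) : Prop :=
  ∀ (x : Rn n) (r : ℝ), 0 < r →
    μ (Metric.ball x (2 * r)) ≤ ENNReal.ofReal C * μ (Metric.ball x r)

/-- A Borel measure with `0 < μ(B) < ∞` for all balls that satisfies the doubling property. -/
structure IsDoubling {n : ℕ} (μ : Measure (Rn n)) : Prop where
  ball_pos : ∀ (x : Rn n) (r : ℝ), 0 < r → 0 < μ (Metric.ball x r)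
  ball_lt_top : ∀ (x : Rn n) (r : ℝ), 0 < r → μ (Metric.ball x r) < ∞
  exists_const : ∃ C : ℝ, IsDoublingConst μ C

/-- The doubling dimension `log₂ C`, with `C` the smallest doubling constant. -/
def doublingDim {n : ℕ} (μ : Measure (Rn n)) : ℝ :=
  Real.logb 2 (sInf {C : ℝ | IsDoublingConst μ C})

/-! ### Dyadic cubes and sparse collections -/

/-- The half-open cube `2^{-k} ([0,1)^n + m + (-1)^k α)` with `α = a / 3`, `a ∈ {0,1,2}^n`. -/
def dyadicCube {n : ℕ} (a : Fin n → Fin 3) (k : ℤ) (m : Fin n → ℤ) : Set (Rn n) :=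
  {x | ∀ i, (2 : ℝ) ^ (-k) * ((m i : ℝ) + (-1 : ℝ) ^ k * (((a i : ℕ) : ℝ) / 3)) ≤ x i ∧
    x i < (2 : ℝ) ^ (-k) * (1 + (m i : ℝ) + (-1 : ℝ) ^ k * (((a i : ℕ) : ℝ) / 3))}

/-- The translated dyadic system with shift `α = a / 3`. -/
def dyadicGrid {n : ℕ} (a : Fin n → Fin 3) : Set (Set (Rn n)) :=
  {Q | ∃ (k : ℤ) (m : Fin n → ℤ), Q = dyadicCube a k m}

/-- The union of the `3^n` translated dyadic systems. -/
def dyadicCubes (n : ℕ) : Set (Set (Rn n)) :=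
  ⋃ a : Fin n → Fin 3, dyadicGrid a

/-- `η`-sparse collections of dyadic cubes: in each of the translated dyadic systems there are
pairwise disjoint measurable sets `E Q ⊆ Q` with `|Q| ≤ η⁻¹ |E Q|`. -/
def IsSparse {n : ℕ} (μ : Measure (Rn n)) (η : ℝ) (S : Set (Set (Rn n))) : Prop :=
  S ⊆ dyadicCubes n ∧
    ∀ a : Fin n → Fin 3, ∃ E : Set (Rn n) → Set (Rn n),
      (∀ Q ∈ S ∩ dyadicGrid a,
        MeasurableSet (E Q) ∧ E Q ⊆ Q ∧ μ Q ≤ ENNReal.ofReal η⁻¹ * μ (E Q)) ∧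
      (S ∩ dyadicGrid a).PairwiseDisjoint E

/-- The average `⟨f⟩_{p,E}`: the `L^p` norm of `f` on `E` for the measure `|E|⁻¹ μ`. -/
def avg {n : ℕ} {F : Type*} [NormedAddCommGroup F] (μ : Measure (Rn n)) (f : Rn n → F)
    (p : ℝ≥0∞) (E : Set (Rn n)) : ℝ≥0∞ :=
  eLpNorm f p ((μ E)⁻¹ • μ.restrict E)

/-! ### Weights -/

/-- A weight: a measurable function with values in `(0, ∞)`. -/
structure IsWeight {n : ℕ} (w : Rn n → ℝ) : Prop where
  measurable : Measurable w
  pos : ∀ x, 0 < w x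

/-- The measure `w dμ`. -/
def weightMeasure {n : ℕ} (μ : Measure (Rn n)) (w : Rn n → ℝ) : Measure (Rn n) :=
  μ.withDensity fun x => ENNReal.ofReal (w x)

/-- The constant `[w]_{A₁}`, the supremum over dyadic cubes of `⟨w⟩_{1,Q} (ess inf_Q w)⁻¹`. -/
def A1Const {n : ℕ} (μ : Measure (Rn n)) (w : Rn n → ℝ) : ℝ≥0∞ :=
  ⨆ Q ∈ dyadicCubes n, avg μ w 1 Q * avg μ (fun x => (w x)⁻¹) ∞ Q

/-- The class `A₁`. -/
structure IsA1 {n : ℕ} (μ : Measure (Rn n)) (w : Rn n → ℝ) : Prop where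
  weight : IsWeight w
  const_lt_top : A1Const μ w < ∞

/-- The uncentered maximal function with respect to balls. -/
def ballMaximal {n : ℕ} (μ : Measure (Rn n)) (f : Rn n → ℝ) (x : Rn n) : ℝ≥0∞ :=
  ⨆ (y : Rn n) (r : ℝ) (_ : 0 < r) (_ : x ∈ Metric.ball y r), avg μ f 1 (Metric.ball y r)

/-- Wilson's constant `[w]_{A_∞} = sup_B w(B)⁻¹ ∫_B M(w χ_B) dμ`. -/
def AInftyConst {n : ℕ} (μ : Measure (Rn n)) (w : Rn n → ℝ) : ℝ≥0∞ :=
  ⨆ (y : Rn n) (r : ℝ) (_ : 0 < r),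
    (∫⁻ x in Metric.ball y r, ballMaximal μ ((Metric.ball y r).indicator w) x ∂μ) /
      weightMeasure μ w (Metric.ball y r)

/-- The class `A_∞`. Local integrability is what makes the quotients in `[w]_{A_∞}` meaningful. -/
structure IsAInfty {n : ℕ} (μ : Measure (Rn n)) (w : Rn n → ℝ) : Prop where
  weight : IsWeight w
  locallyIntegrable : LocallyIntegrable w μ
  const_lt_top : AInftyConst μ w < ∞

open Classical in
/-- The constant `[w]_{RH_s}` for `1 ≤ s ≤ ∞`, with `[w]_{RH_1} = 1`. -/
def RHConst {n : ℕ} (μ : Measure (Rn n)) (s : ℝ≥0∞) (w : Rn n → ℝ) : ℝ≥0∞ :=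
  if s = 1 then 1 else ⨆ Q ∈ dyadicCubes n, avg μ w s Q * (avg μ w 1 Q)⁻¹

/-- The reverse Hölder class `RH_s` for `1 ≤ s ≤ ∞`, with `RH_1 = A_∞`. -/
def IsRH {n : ℕ} (μ : Measure (Rn n)) (s : ℝ≥0∞) (w : Rn n → ℝ) : Prop :=
  (s = 1 → IsAInfty μ w) ∧
    (s ≠ 1 → IsWeight w ∧ LocallyIntegrable w μ ∧ RHConst μ s w < ∞)

/-! ### Test functions and sparsely dominated operators -/

/-- A space of test functions: a linear space of functions that is contained and dense in `L^q(w)`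
for all `1 ≤ q < ∞` and all `w ∈ A_∞`, and such that a function is determined almost everywhere by
its pairings with test functions (as is the case for smooth compactly supported functions). -/
structure IsTestSpace {n : ℕ} {𝕜 : Type*} [RCLike 𝕜] (μ : Measure (Rn n))
    (D : Submodule 𝕜 (Rn n → 𝕜)) : Prop where
  memLp : ∀ (q : ℝ≥0∞) (w : Rn n → ℝ), 1 ≤ q → q < ∞ → IsAInfty μ w →
    ∀ f ∈ D, MemLp f q (weightMeasure μ w)
  dense : ∀ (q : ℝ≥0∞) (w : Rn n → ℝ), 1 ≤ q → q < ∞ → IsAInfty μ w →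
    ∀ h : Rn n → 𝕜, MemLp h q (weightMeasure μ w) →
      ∀ ε : ℝ≥0∞, 0 < ε → ∃ f ∈ D, eLpNorm (h - f) q (weightMeasure μ w) ≤ ε
  separating : ∀ u : Rn n → 𝕜, AEStronglyMeasurable u μ →
    (∀ g ∈ D, Integrable (fun x => u x * g x) μ ∧ ∫ x, u x * g x ∂μ = 0) →
      ∀ᵐ x ∂μ, u x = 0

/-- `T`, initially defined on the test functions `D`, is a (sub)linear operator in the class
`S(p₀, q₀)` of sparsely dominated operators, with constants `c` and `η`:
`|⟨Tf, g⟩| ≤ c ∑_{Q ∈ S} ⟨f⟩_{p₀,Q} ⟨g⟩_{q₀',Q} |Q|` for some `η`-sparse `S`, for all `f, g ∈ D`.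
The values of `T` outside `D` play no role. -/
structure IsSparselyDominated {n : ℕ} {𝕜 : Type*} [RCLike 𝕜] (μ : Measure (Rn n))
    (D : Submodule 𝕜 (Rn n → 𝕜)) (p₀ q₀ : ℝ≥0∞) (c η : ℝ)
    (T : (Rn n → 𝕜) → (Rn n → 𝕜)) : Prop where
  norm_add_le : ∀ f ∈ D, ∀ g ∈ D, ∀ᵐ x ∂μ, ‖T (f + g) x‖ ≤ ‖T f x‖ + ‖T g x‖
  norm_smul : ∀ (a : 𝕜), ∀ f ∈ D, ∀ᵐ x ∂μ, ‖T (a • f) x‖ = ‖a‖ * ‖T f x‖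
  aestronglyMeasurable : ∀ f ∈ D, AEStronglyMeasurable (T f) μ
  integrable_pairing : ∀ f ∈ D, ∀ g ∈ D, Integrable (fun x => T f x * g x) μ
  domination : ∀ f ∈ D, ∀ g ∈ D, ∃ S : Set (Set (Rn n)), IsSparse μ η S ∧
    ‖∫ x, T f x * g x ∂μ‖ₑ ≤
      ENNReal.ofReal c *
        ∑' Q : S, avg μ f p₀ (Q : Set (Rn n)) * avg μ g q₀.conjExponent (Q : Set (Rn n)) *
          μ (Q : Set (Rn n))

/-- The norm of `T` as an operator on `L^p(w)`, where `T` is given on the dense subspace `D`: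
the least `K` with `‖Tf‖_{L^p(w)} ≤ K ‖f‖_{L^p(w)}` for all `f ∈ D`. -/
def weightedOpNorm {n : ℕ} {𝕜 : Type*} [RCLike 𝕜] (μ : Measure (Rn n))
    (D : Submodule 𝕜 (Rn n → 𝕜)) (p : ℝ≥0∞) (w : Rn n → ℝ)
    (T : (Rn n → 𝕜) → (Rn n → 𝕜)) : ℝ≥0∞ :=
  sInf {K : ℝ≥0∞ | ∀ f ∈ D,
    eLpNorm (T f) p (weightMeasure μ w) ≤ K * eLpNorm f p (weightMeasure μ w)}

/-! ### The explicit constants -/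

/-- `c_p = [(p'/q₀')']^{1/q₀'} [(p₀'/p')' (p/p₀)']^{1/p₀}`. -/
def cConst (p₀ p q₀ : ℝ≥0∞) : ℝ≥0∞ :=
  ((p.conjExponent / q₀.conjExponent).conjExponent) ^ (1 / q₀.conjExponent.toReal) *
    ((p₀.conjExponent / p.conjExponent).conjExponent * (p / p₀).conjExponent) ^ (1 / p₀.toReal)

open Classical in
/-- The exponent `(q₀ - 1) / (q₀ - p)`, understood as its limit `1` for `q₀ = ∞`. -/
def finalExponent (p q₀ : ℝ≥0∞) : ℝ :=
  if q₀ = ∞ then 1 else (q₀.toReal - 1) / (q₀.toReal - p.toReal)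

end SparseWeights

end

namespace SparseWeights

/-! ### The doubling constant -/

theorem IsDoublingConst.one_le {n : ℕ} {μ : Measure (Rn n)} (hμ : IsDoubling μ) {C : ℝ}
    (hC : IsDoublingConst μ C) : 1 ≤ C := by
  by_contra! h
  have h1 := hC 0 1 one_pos
  have hp := hμ.ball_pos 0 1 one_pos
  have hf := hμ.ball_lt_top 0 1 one_pos
  have h2 : μ (Metric.ball 0 1) ≤ μ (Metric.ball 0 (2 * 1)) :=
    measure_mono (Metric.ball_subset_ball (by norm_num))
  have h3 : ENNReal.ofReal C * μ (Metric.ball 0 1) < 1 * μ (Metric.ball 0 1) :=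
    ENNReal.mul_lt_mul_left hp.ne' hf.ne (by
      rw [← ENNReal.ofReal_one]; exact (ENNReal.ofReal_lt_ofReal_iff one_pos).2 h)
  rw [one_mul] at h3
  exact absurd (h2.trans h1) (not_le.2 h3)

theorem isDoublingConst_two_rpow {n : ℕ} {μ : Measure (Rn n)} (hμ : IsDoubling μ) :
    IsDoublingConst μ (2 ^ doublingDim μ) := by
  obtain ⟨C₀, hC₀⟩ := hμ.exists_const
  have hne : {C : ℝ | IsDoublingConst μ C}.Nonempty := ⟨C₀, hC₀⟩
  have h1 : 1 ≤ sInf {C : ℝ | IsDoublingConst μ C} :=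
    le_csInf hne fun C hC => hC.one_le hμ
  rw [doublingDim, Real.rpow_logb two_pos (by norm_num) (by linarith)]
  intro x r hr
  have hf := hμ.ball_lt_top x r hr
  have hp := hμ.ball_pos x r hr
  rw [← ENNReal.div_le_iff hp.ne' hf.ne]
  have h2 : μ (Metric.ball x (2 * r)) / μ (Metric.ball x r) ≠ ∞ :=
    ENNReal.div_ne_top (hμ.ball_lt_top x _ (by linarith)).ne hp.ne'
  rw [ENNReal.le_ofReal_iff_toReal_le h2 (by linarith)]
  refine le_csInf hne fun C hC => ?_
  have h3 := hC x r hr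
  rw [← ENNReal.div_le_iff hp.ne' hf.ne] at h3
  exact ENNReal.toReal_le_of_le_ofReal (by linarith [hC.one_le hμ]) h3

theorem IsDoublingConst.pow {n : ℕ} {μ : Measure (Rn n)} {C : ℝ} (hC : IsDoublingConst μ C)
    (x : Rn n) {r : ℝ} (hr : 0 < r) (j : ℕ) :
    μ (Metric.ball x (2 ^ j * r)) ≤ ENNReal.ofReal C ^ j * μ (Metric.ball x r) := by
  induction j with
  | zero => simp
  | succ j ih =>
    calc μ (Metric.ball x (2 ^ (j + 1) * r)) = μ (Metric.ball x (2 * (2 ^ j * r))) := by ring_nf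
      _ ≤ ENNReal.ofReal C * μ (Metric.ball x (2 ^ j * r)) := hC x _ (by positivity)
      _ ≤ ENNReal.ofReal C * (ENNReal.ofReal C ^ j * μ (Metric.ball x r)) := by gcongr
      _ = _ := by rw [pow_succ]; ring

/-! ### Geometry of dyadic cubes -/

/-- The lower left corner of a dyadic cube. -/
noncomputable def corner {n : ℕ} (a : Fin n → Fin 3) (k : ℤ) (m : Fin n → ℤ) (i : Fin n) : ℝ :=
  (2 : ℝ) ^ (-k) * ((m i : ℝ) + (-1 : ℝ) ^ k * (((a i : ℕ) : ℝ) / 3))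

theorem mem_dyadicCube {n : ℕ} {a : Fin n → Fin 3} {k : ℤ} {m : Fin n → ℤ} {x : Rn n} :
    x ∈ dyadicCube a k m ↔
      ∀ i, corner a k m i ≤ x i ∧ x i < corner a k m i + (2 : ℝ) ^ (-k) := by
  simp only [dyadicCube, corner, mem_ofPred_eq]
  refine forall_congr' fun i => and_congr Iff.rfl ?_
  rw [show (2 : ℝ) ^ (-k) * (1 + (m i : ℝ) + (-1 : ℝ) ^ k * (((a i : ℕ) : ℝ) / 3)) =
    (2 : ℝ) ^ (-k) * ((m i : ℝ) + (-1 : ℝ) ^ k * (((a i : ℕ) : ℝ) / 3)) + (2 : ℝ) ^ (-k) by ring]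

theorem measurableSet_dyadicCube {n : ℕ} (a : Fin n → Fin 3) (k : ℤ) (m : Fin n → ℤ) :
    MeasurableSet (dyadicCube a k m) := by
  have : dyadicCube a k m = ⋂ i, {x : Rn n | corner a k m i ≤ x i} ∩
      {x | x i < corner a k m i + (2 : ℝ) ^ (-k)} := by
    ext x; simp [mem_dyadicCube]
  rw [this]
  refine MeasurableSet.iInter fun i => ?_
  have hi : Measurable fun x : Rn n => x i := by fun_prop
  exact (measurableSet_le measurable_const hi).inter (measurableSet_lt hi measurable_const)

theorem countable_dyadicCubes (n : ℕ) : (dyadicCubes n).Countable := by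
  refine countable_iUnion fun a => ?_
  have : dyadicGrid a = range fun p : ℤ × (Fin n → ℤ) => dyadicCube a p.1 p.2 := by
    ext Q; simp [dyadicGrid, eq_comm]
  rw [this]
  exact countable_range _

theorem measurableSet_of_mem_grid {n : ℕ} {a : Fin n → Fin 3} {Q : Set (Rn n)}
    (hQ : Q ∈ dyadicGrid a) : MeasurableSet Q := by
  obtain ⟨k, m, rfl⟩ := hQ
  exact measurableSet_dyadicCube a k m

theorem dyadicGrid_subset {n : ℕ} (a : Fin n → Fin 3) : dyadicGrid a ⊆ dyadicCubes n :=
  subset_iUnion dyadicGrid a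

theorem measurableSet_of_mem_cubes {n : ℕ} {Q : Set (Rn n)} (hQ : Q ∈ dyadicCubes n) :
    MeasurableSet Q := by
  obtain ⟨a, ha⟩ := mem_iUnion.1 hQ
  exact measurableSet_of_mem_grid ha

/-- Corners of a cube at level `k` are corners at every finer level `k + j`. -/
theorem exists_corner_eq {n : ℕ} (a : Fin n → Fin 3) (k : ℤ) (m : Fin n → ℤ) (j : ℕ)
    (i : Fin n) : ∃ N : ℤ, corner a k m i =
      (2 : ℝ) ^ (-(k + j)) * ((N : ℝ) + (-1 : ℝ) ^ (k + j) * (((a i : ℕ) : ℝ) / 3)) := by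
  induction j with
  | zero => exact ⟨m i, by simp [corner]⟩
  | succ j ih =>
    obtain ⟨N, hN⟩ := ih
    obtain ⟨e, he⟩ : ∃ e : ℤ, (-1 : ℝ) ^ (k + j) = e := by
      rcases Int.even_or_odd (k + j) with h | h
      · exact ⟨1, by simp [h.neg_one_zpow]⟩
      · exact ⟨-1, by simp [h.neg_one_zpow]⟩
    refine ⟨2 * N + e * (a i : ℕ), ?_⟩
    rw [hN]
    have h2 : (2 : ℝ) ^ (-(k + j)) = 2 * 2 ^ (-(k + (j + 1 : ℕ))) := by
      rw [← zpow_one_add₀ (by norm_num)]; congr 1; push_cast; ring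
    have h1 : (-1 : ℝ) ^ (k + (j + 1 : ℕ)) = -(-1 : ℝ) ^ (k + j) := by
      rw [show k + ((j + 1 : ℕ) : ℤ) = (k + j) + 1 by push_cast; ring,
        zpow_add_one₀ (by norm_num)]; ring
    rw [h2, h1, he]
    push_cast
    ring

/-- A cube is contained in every coarser cube of the same grid that it intersects. -/
theorem dyadicCube_subset_of_le {n : ℕ} {a : Fin n → Fin 3} {k k' : ℤ} {m m' : Fin n → ℤ}
    (hk : k ≤ k') (h : ¬ Disjoint (dyadicCube a k' m') (dyadicCube a k m)) :
    dyadicCube a k' m' ⊆ dyadicCube a k m := by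
  obtain ⟨x, hx', hx⟩ := not_disjoint_iff.1 h
  obtain ⟨j, rfl⟩ := Int.le.dest hk
  rw [mem_dyadicCube] at hx hx'
  intro y hy
  rw [mem_dyadicCube] at hy ⊢
  intro i
  obtain ⟨N, hN⟩ := exists_corner_eq a k m j i
  have hl : (0 : ℝ) < 2 ^ (-(k + j : ℤ)) := by positivity
  set l : ℝ := 2 ^ (-(k + j : ℤ)) with hldef
  have hL : (2 : ℝ) ^ (-k) = l * ((2 ^ j : ℕ) : ℤ) := by
    rw [hldef]; push_cast
    rw [← zpow_natCast, ← zpow_add₀ (by norm_num)]; congr 1; ring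
  have hc' : corner a (k + j) m' i = corner a k m i + l * ((m' i - N : ℤ) : ℝ) := by
    rw [hN]; simp only [corner]; push_cast; ring
  have hxi := hx i
  have hxi' := hx' i
  have hyi := hy i
  rw [hL] at hxi ⊢
  rw [hc'] at hxi' hyi
  set d : ℤ := m' i - N
  have h1 : (0 : ℝ) < l * ((d + 1 : ℤ) : ℝ) := by push_cast; linarith
  have h2 : 0 < d + 1 := by
    have := pos_of_mul_pos_right h1 hl.le; exact_mod_cast this
  have h3 : l * ((d : ℤ) : ℝ) < l * ((2 ^ j : ℕ) : ℤ) := by linarith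
  have h4 : d < (2 ^ j : ℕ) := by
    have := lt_of_mul_lt_mul_left h3 hl.le; exact_mod_cast this
  have h5 : (0 : ℝ) ≤ (d : ℝ) := by exact_mod_cast (by omega : 0 ≤ d)
  have h6 : ((d : ℤ) : ℝ) + 1 ≤ (((2 ^ j : ℕ) : ℤ) : ℝ) := by
    exact_mod_cast (by omega : d + 1 ≤ ((2 ^ j : ℕ) : ℤ))
  have h7 := mul_le_mul_of_nonneg_left h6 hl.le
  have h8 := mul_nonneg hl.le h5
  constructor <;> nlinarith

theorem grid_laminar {n : ℕ} {a : Fin n → Fin 3} {Q Q' : Set (Rn n)} (hQ : Q ∈ dyadicGrid a)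
    (hQ' : Q' ∈ dyadicGrid a) : Q ⊆ Q' ∨ Q' ⊆ Q ∨ Disjoint Q Q' := by
  obtain ⟨k, m, rfl⟩ := hQ
  obtain ⟨k', m', rfl⟩ := hQ'
  by_cases h : Disjoint (dyadicCube a k m) (dyadicCube a k' m')
  · exact Or.inr (Or.inr h)
  rcases le_total k k' with hk | hk
  · exact Or.inr (Or.inl (dyadicCube_subset_of_le hk fun h' => h h'.symm))
  · exact Or.inl (dyadicCube_subset_of_le hk h)

/-- The centre of a dyadic cube. -/
noncomputable def center {n : ℕ} (a : Fin n → Fin 3) (k : ℤ) (m : Fin n → ℤ) : Rn n :=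
  WithLp.toLp 2 fun i => corner a k m i + (2 : ℝ) ^ (-k) / 2

theorem ball_center_subset {n : ℕ} (a : Fin n → Fin 3) (k : ℤ) (m : Fin n → ℤ) :
    Metric.ball (center a k m) ((2 : ℝ) ^ (-k) / 2) ⊆ dyadicCube a k m := by
  intro x hx
  rw [mem_ball_iff_norm] at hx
  rw [mem_dyadicCube]
  intro i
  have h := (PiLp.norm_apply_le (x - center a k m) i).trans_lt hx
  have hc : (center a k m) i = corner a k m i + (2 : ℝ) ^ (-k) / 2 := rfl
  rw [PiLp.sub_apply, hc, Real.norm_eq_abs, abs_lt] at h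
  constructor <;> linarith

theorem norm_le_sqrt_mul {n : ℕ} (x : Rn n) {d : ℝ} (hd : 0 ≤ d) (h : ∀ i, |x i| ≤ d) :
    ‖x‖ ≤ √n * d := by
  rw [EuclideanSpace.norm_eq]
  calc √(∑ i, ‖x i‖ ^ 2) ≤ √(∑ _i : Fin n, d ^ 2) := by
        gcongr with i; exact h i
    _ = √n * d := by simp [Real.sqrt_mul, Real.sqrt_sq hd]

theorem norm_sub_center_le {n : ℕ} {a : Fin n → Fin 3} {k : ℤ} {m : Fin n → ℤ} {x : Rn n}
    (hx : x ∈ dyadicCube a k m) : ‖x - center a k m‖ ≤ √n * ((2 : ℝ) ^ (-k) / 2) := by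
  refine norm_le_sqrt_mul _ (by positivity) fun i => ?_
  have h := mem_dyadicCube.1 hx i
  have hc : (center a k m) i = corner a k m i + (2 : ℝ) ^ (-k) / 2 := rfl
  rw [PiLp.sub_apply, hc, abs_le]
  constructor <;> linarith

theorem norm_sub_le_of_mem_cube {n : ℕ} {a : Fin n → Fin 3} {k : ℤ} {m : Fin n → ℤ} {x y : Rn n}
    (hx : x ∈ dyadicCube a k m) (hy : y ∈ dyadicCube a k m) :
    ‖x - y‖ ≤ √n * (2 : ℝ) ^ (-k) := by
  refine norm_le_sqrt_mul _ (by positivity) fun i => ?_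
  have h := mem_dyadicCube.1 hx i
  have h' := mem_dyadicCube.1 hy i
  rw [PiLp.sub_apply, abs_le]
  constructor <;> linarith

theorem center_mem {n : ℕ} (a : Fin n → Fin 3) (k : ℤ) (m : Fin n → ℤ) :
    center a k m ∈ dyadicCube a k m :=
  ball_center_subset a k m (Metric.mem_ball_self (by positivity))

theorem level_le_of_subset {n : ℕ} (hn : 0 < n) {a : Fin n → Fin 3} {k k' : ℤ}
    {m m' : Fin n → ℤ} (h : dyadicCube a k' m' ⊆ dyadicCube a k m) : k ≤ k' := by
  by_contra! hk
  have hsub : dyadicCube a k m ⊆ dyadicCube a k' m' := dyadicCube_subset_of_le hk.le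
    (not_disjoint_iff.2 ⟨_, h (center_mem a k' m'), center_mem a k' m'⟩)
  have heq := h.antisymm hsub
  let i : Fin n := ⟨0, hn⟩
  have hc : WithLp.toLp 2 (corner a k' m') ∈ dyadicCube a k' m' := by
    rw [mem_dyadicCube]; intro j
    exact ⟨le_rfl, by change corner a k' m' j < _; have : (0 : ℝ) < 2 ^ (-k') := by positivity
                      linarith⟩
  set t : ℝ := 2 ^ (-k) with ht
  have htlt : t < 2 ^ (-k') := zpow_lt_zpow_right₀ (by norm_num) (by omega)
  have ht0 : 0 < t := by positivity
  have hd : WithLp.toLp 2 (fun j => corner a k' m' j + t) ∈ dyadicCube a k' m' := by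
    rw [mem_dyadicCube]; intro j
    change corner a k' m' j ≤ corner a k' m' j + t ∧ corner a k' m' j + t < _
    exact ⟨by linarith, by linarith⟩
  rw [heq] at hc hd
  have h1 := mem_dyadicCube.1 hc i
  have h2 := mem_dyadicCube.1 hd i
  change corner a k m i ≤ corner a k' m' i ∧ corner a k' m' i < corner a k m i + t at h1
  change corner a k m i ≤ corner a k' m' i + t ∧ corner a k' m' i + t < corner a k m i + t at h2
  linarith

/-- One third trick in one coordinate. -/
theorem exists_third_interval (x ρ : ℝ) (hρ : ρ ≤ 1 / 6) (e : ℝ)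
    (he : e = 1 ∨ e = -1) : ∃ (a : Fin 3) (m : ℤ),
      (m : ℝ) + e * (((a : ℕ) : ℝ) / 3) ≤ x - ρ ∧ x + ρ ≤ m + e * (((a : ℕ) : ℝ) / 3) + 1 := by
  have h0 := Int.floor_le x
  have h1 := Int.lt_floor_add_one x
  by_cases hl : x - ⌊x⌋ < 1 / 6
  · rcases he with rfl | rfl
    · exact ⟨1, ⌊x⌋ - 1, by push_cast; norm_num; linarith, by push_cast; norm_num; linarith⟩
    · exact ⟨1, ⌊x⌋, by norm_num; linarith, by norm_num; linarith⟩
  by_cases hr : 5 / 6 < x - ⌊x⌋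
  · rcases he with rfl | rfl
    · exact ⟨1, ⌊x⌋, by norm_num; linarith, by norm_num; linarith⟩
    · exact ⟨1, ⌊x⌋ + 1, by push_cast; norm_num; linarith, by push_cast; norm_num; linarith⟩
  · exact ⟨0, ⌊x⌋, by simp; linarith, by simp; linarith⟩

/-- Every ball is contained in a dyadic cube of comparable side length. -/
theorem exists_dyadicCube_ball_subset {n : ℕ} (y : Rn n) {r : ℝ} (hr : 0 < r) :
    ∃ (a : Fin n → Fin 3) (k : ℤ) (m : Fin n → ℤ),
      Metric.ball y r ⊆ dyadicCube a k m ∧ (2 : ℝ) ^ (-k) ≤ 12 * r := by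
  obtain ⟨j, hj1, hj2⟩ := exists_mem_Ico_zpow (x := 12 * r) (y := (2 : ℝ)) (by positivity)
    (by norm_num)
  have hl : (0 : ℝ) < 2 ^ j := by positivity
  have h6 : 6 * r ≤ 2 ^ j := by
    rw [zpow_add_one₀ (by norm_num)] at hj2; linarith
  have he : ((-1 : ℝ) ^ (-j)) = 1 ∨ ((-1 : ℝ) ^ (-j)) = -1 := by
    rcases Int.even_or_odd (-j) with h | h
    · exact Or.inl h.neg_one_zpow
    · exact Or.inr h.neg_one_zpow
  have hρ : r / 2 ^ j ≤ 1 / 6 := by rw [div_le_div_iff₀ hl (by norm_num)]; linarith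
  choose a m ham using fun i => exists_third_interval (y i / 2 ^ j) (r / 2 ^ j) hρ _ he
  refine ⟨a, -j, m, fun x hx => ?_, by simpa using hj1⟩
  rw [mem_dyadicCube]
  intro i
  rw [mem_ball_iff_norm] at hx
  have h := (PiLp.norm_apply_le (x - y) i).trans_lt hx
  rw [PiLp.sub_apply, Real.norm_eq_abs, abs_lt] at h
  obtain ⟨h1, h2⟩ := ham i
  have h1' := mul_le_mul_of_nonneg_left h1 hl.le
  have h2' := mul_le_mul_of_nonneg_left h2 hl.le
  have e1 : (2 : ℝ) ^ j * (y i / 2 ^ j - r / 2 ^ j) = y i - r := by field_simp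
  have e2 : (2 : ℝ) ^ j * (y i / 2 ^ j + r / 2 ^ j) = y i + r := by field_simp
  rw [e1] at h1'
  rw [e2] at h2'
  simp only [corner, neg_neg]
  constructor <;> linarith

/-- The facts about a doubling measure that relate cubes and balls: `K` bounds the ratio of the
measures of cubes and of balls of comparable size, and `U Q` is a ball around the cube `Q`. -/
structure Comparison {n : ℕ} (μ : Measure (Rn n)) (K : ℝ≥0∞) : Prop where
  one_le : 1 ≤ K
  ne_top : K ≠ ∞
  exists_cube : ∀ (y : Rn n) (r : ℝ), 0 < r → ∃ R ∈ dyadicCubes n, Metric.ball y r ⊆ R ∧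
    μ R ≤ K * μ (Metric.ball y r)
  exists_ball : ∀ a : Fin n → Fin 3, ∃ U : Set (Rn n) → Set (Rn n), ∀ Q ∈ dyadicGrid a,
    (∃ (y : Rn n) (r : ℝ), 0 < r ∧ U Q = Metric.ball y r) ∧ Q ⊆ U Q ∧ μ (U Q) ≤ K * μ Q ∧
      ∀ Q' ∈ dyadicGrid a, Q' ⊆ Q → U Q' ⊆ U Q

theorem exists_comparison {n : ℕ} (hn : 0 < n) (ν : ℝ) : ∃ K : ℝ≥0∞,
    ∀ μ : Measure (Rn n), IsDoubling μ → doublingDim μ = ν → Comparison μ K := by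
  obtain ⟨j, hj⟩ := pow_unbounded_of_one_lt (12 * √n + 1) (one_lt_two)
  have hsn : 1 ≤ √(n : ℝ) := by rw [Real.one_le_sqrt]; exact_mod_cast hn
  refine ⟨(max 1 (ENNReal.ofReal (2 ^ ν))) ^ j, fun μ hμ hν => ?_⟩
  have hC : IsDoublingConst μ (2 ^ ν) := hν ▸ isDoublingConst_two_rpow hμ
  have hC' : max 1 (ENNReal.ofReal (2 ^ ν)) = ENNReal.ofReal (2 ^ ν) := max_eq_right <| by
    rw [← ENNReal.ofReal_one]; exact ENNReal.ofReal_le_ofReal (hC.one_le hμ)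
  rw [hC']
  refine ⟨?_, by finiteness, fun y r hr => ?_, fun a => ?_⟩
  · rw [← hC']; exact one_le_pow₀ (le_max_left _ _)
  · obtain ⟨a, k, m, h1, h2⟩ := exists_dyadicCube_ball_subset y hr
    refine ⟨_, dyadicGrid_subset a ⟨k, m, rfl⟩, h1, le_trans (measure_mono fun x hx => ?_)
      (hC.pow y hr j)⟩
    rw [mem_ball_iff_norm]
    refine (norm_sub_le_of_mem_cube hx (h1 (Metric.mem_ball_self hr))).trans_lt ?_
    calc √n * (2 : ℝ) ^ (-k) ≤ √n * (12 * r) := by gcongr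
      _ < (12 * √n + 1) * r := by nlinarith
      _ ≤ 2 ^ j * r := by gcongr
  · have hex : ∀ Q : Set (Rn n), ∃ p : ℤ × (Fin n → ℤ), Q ∈ dyadicGrid a →
        Q = dyadicCube a p.1 p.2 := fun Q => by
      by_cases hQ : Q ∈ dyadicGrid a
      · obtain ⟨k, m, h⟩ := hQ
        exact ⟨(k, m), fun _ => h⟩
      · exact ⟨(0, 0), fun h => absurd h hQ⟩
    choose f hf using hex
    refine ⟨fun Q => Metric.ball (center a (f Q).1 (f Q).2) (√n * (2 : ℝ) ^ (-(f Q).1)),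
      fun Q hQ => ⟨⟨_, _, by positivity, rfl⟩, fun x hx => ?_, ?_, fun Q' hQ' hs => ?_⟩⟩
    · rw [hf Q hQ] at hx
      rw [mem_ball_iff_norm]
      refine (norm_sub_center_le hx).trans_lt ?_
      gcongr
      have : (0 : ℝ) < 2 ^ (-(f Q).1) := by positivity
      linarith
    · refine le_trans (measure_mono (Metric.ball_subset_ball ?_))
        ((hC.pow (center a (f Q).1 (f Q).2) (r := (2 : ℝ) ^ (-(f Q).1) / 2) (by positivity) j).trans
        (mul_le_mul_right (measure_mono ?_) _))
      · have : (0 : ℝ) < 2 ^ (-(f Q).1) := by positivity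
        nlinarith
      · conv_rhs => rw [hf Q hQ]
        exact ball_center_subset _ _ _
    · rcases eq_or_ne Q' Q with rfl | hne
      · exact subset_rfl
      have hsub : dyadicCube a (f Q').1 (f Q').2 ⊆ dyadicCube a (f Q).1 (f Q).2 := by
        rw [← hf Q hQ, ← hf Q' hQ']; exact hs
      have hlt : (f Q).1 < (f Q').1 := by
        refine lt_of_le_of_ne (level_le_of_subset hn hsub) fun heq => hne ?_
        rw [hf Q hQ, hf Q' hQ']
        refine hsub.antisymm (dyadicCube_subset_of_le heq.symm.le ?_)
        exact not_disjoint_iff.2 ⟨_, hsub (center_mem _ _ _), center_mem _ _ _⟩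
      have hl : (2 : ℝ) ^ (-(f Q').1) ≤ 2 ^ (-(f Q).1) / 2 := by
        rw [div_eq_mul_inv, ← zpow_sub_one₀ (by norm_num)]
        exact zpow_le_zpow_right₀ (by norm_num) (by omega)
      refine Metric.ball_subset_ball' ?_
      rw [dist_eq_norm]
      have := norm_sub_center_le (hsub (center_mem _ _ _))
      nlinarith

/-! ### The Carleson embedding theorem -/

theorem lintegral_Ioo_rpow {r b : ℝ} (hr : 0 < r) (hb : 0 ≤ b) :
    ∫⁻ τ in Ioo 0 b, ENNReal.ofReal (r * τ ^ (r - 1)) = ENNReal.ofReal (b ^ r) := by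
  rw [← ofReal_integral_eq_lintegral_ofReal]
  · rw [← integral_Ioc_eq_integral_Ioo, ← intervalIntegral.integral_of_le hb,
      intervalIntegral.integral_const_mul, integral_rpow (Or.inl (by linarith))]
    congr 1
    rw [sub_add_cancel, Real.zero_rpow hr.ne', sub_zero]
    field_simp
  · have h := (intervalIntegral.intervalIntegrable_rpow' (a := 0) (b := b)
      (by linarith : -1 < r - 1)).const_mul r
    rw [intervalIntegrable_iff_integrableOn_Ioo_of_le hb] at h
    exact h
  · refine (ae_restrict_iff' measurableSet_Ioo).2 (Filter.Eventually.of_forall fun τ hτ => ?_)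
    have := hτ.1
    positivity

/-- Layer cake representation of a power of an extended nonnegative real. -/
theorem lintegral_layer {r : ℝ} (hr : 0 < r) (a : ℝ≥0∞) :
    ∫⁻ τ in Ioi (0 : ℝ), {τ : ℝ | ENNReal.ofReal τ < a}.indicator
      (fun τ => ENNReal.ofReal (r * τ ^ (r - 1))) τ = a ^ r := by
  have hm : ∀ a : ℝ≥0∞, MeasurableSet {τ : ℝ | ENNReal.ofReal τ < a} := fun a =>
    measurableSet_lt ENNReal.measurable_ofReal measurable_const
  have hfin : ∀ b : ℝ, 0 ≤ b → ∫⁻ τ in Ioi (0 : ℝ), {τ : ℝ | ENNReal.ofReal τ < ENNReal.ofReal b}.indicator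
      (fun τ => ENNReal.ofReal (r * τ ^ (r - 1))) τ = ENNReal.ofReal b ^ r := by
    intro b hb
    rw [lintegral_indicator (hm _), Measure.restrict_restrict (hm _),
      ENNReal.ofReal_rpow_of_nonneg hb hr.le, ← lintegral_Ioo_rpow hr hb]
    congr 2
    ext τ
    simp only [mem_inter_iff, mem_ofPred_eq, mem_Ioi, mem_Ioo]
    constructor
    · rintro ⟨h1, h2⟩
      exact ⟨h2, (ENNReal.ofReal_lt_ofReal_iff_of_nonneg h2.le).1 h1⟩
    · rintro ⟨h1, h2⟩
      exact ⟨(ENNReal.ofReal_lt_ofReal_iff_of_nonneg h1.le).2 h2, h1⟩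
  rcases eq_or_ne a ∞ with rfl | ha
  · rw [ENNReal.top_rpow_of_pos hr]
    refine ENNReal.eq_top_of_forall_nnreal_le fun N => ?_
    have h1 := hfin ((N : ℝ) ^ r⁻¹) (by positivity)
    rw [ENNReal.ofReal_rpow_of_nonneg (by positivity) hr.le, Real.rpow_inv_rpow N.coe_nonneg hr.ne',
      ENNReal.ofReal_coe_nnreal] at h1
    rw [← h1]
    refine lintegral_mono fun τ => indicator_le_indicator_of_subset (fun x hx => ?_) (by simp) _
    simp
  · have := hfin a.toReal ENNReal.toReal_nonneg
    rwa [ENNReal.ofReal_toReal ha] at this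

open Classical in
theorem sum_maximal_le {α : Type*} (F : Finset (Set α))
    (c : Set α → ℝ≥0∞) :
    ∑ Q ∈ F, c Q ≤ ∑ R ∈ F with (∀ Q ∈ F, R ⊆ Q → R = Q), ∑ Q ∈ F with Q ⊆ R, c Q := by
  simp_rw [Finset.sum_filter (fun Q => Q ⊆ _) c]
  rw [Finset.sum_comm]
  refine Finset.sum_le_sum fun Q hQ => ?_
  obtain ⟨R, hQR, hR⟩ := F.exists_le_maximal hQ
  refine le_trans (le_of_eq (if_pos hQR).symm)
    (Finset.single_le_sum (f := fun R => if Q ⊆ R then c Q else 0) (fun _ _ => zero_le)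
      (Finset.mem_filter.2 ⟨hR.1, fun Q' hQ' h => h.antisymm (hR.2 hQ' h)⟩))

open Classical in
/-- Carleson embedding theorem for a finite laminar family of sets. -/
theorem carleson_embedding {α : Type*} [MeasurableSpace α] (ω : Measure α) [SFinite ω]
    (S : Finset (Set α)) (hlam : ∀ Q ∈ S, ∀ Q' ∈ S, Q ⊆ Q' ∨ Q' ⊆ Q ∨ Disjoint Q Q')
    (hmeas : ∀ Q ∈ S, MeasurableSet Q) (c W : Set α → ℝ≥0∞)
    (hW0 : ∀ Q ∈ S, W Q ≠ 0) (hWt : ∀ Q ∈ S, W Q ≠ ∞) (hW : ∀ Q ∈ S, ω Q ≤ W Q) (A : ℝ≥0∞)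
    (hA : ∀ R ∈ S, ∑ Q ∈ S with Q ⊆ R, c Q ≤ A * W R) {t : ℝ} (ht : 1 < t)
    (h : α → ℝ≥0∞) (hh : AEMeasurable h ω) :
    ∑ Q ∈ S, c Q * ((∫⁻ x in Q, h x ∂ω) / W Q) ^ t ≤
      A * (ENNReal.ofReal (2 ^ t * (t / (t - 1))) * ∫⁻ x, h x ^ t ∂ω) := by
  -- It suffices to treat measurable functions.
  wlog hm : Measurable h generalizing h
  · have := this (hh.mk h) hh.measurable_mk.aemeasurable hh.measurable_mk
    have e1 : ∀ Q, ∫⁻ x in Q, h x ∂ω = ∫⁻ x in Q, hh.mk h x ∂ω := fun Q =>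
      lintegral_congr_ae (ae_restrict_of_ae hh.ae_eq_mk)
    have e2 : ∫⁻ x, h x ^ t ∂ω = ∫⁻ x, hh.mk h x ^ t ∂ω :=
      lintegral_congr_ae (hh.ae_eq_mk.mono fun x hx => by simp only [hx])
    simp only [e1, e2]
    exact this
  have ht0 : 0 < t := by linarith
  set a : Set α → ℝ≥0∞ := fun Q => (∫⁻ x in Q, h x ∂ω) / W Q with ha
  -- the weak type estimate
  have weak : ∀ τ : ℝ, 0 < τ → ∑ Q ∈ S with ENNReal.ofReal τ < a Q, c Q ≤
      A * (ENNReal.ofReal (2 / τ) *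
        ∫⁻ x, {x | ENNReal.ofReal (τ / 2) < h x}.indicator h x ∂ω) := by
    intro τ hτ
    set F := S.filter fun Q => ENNReal.ofReal τ < a Q with hF
    set g : α → ℝ≥0∞ := {x | ENNReal.ofReal (τ / 2) < h x}.indicator h with hg
    have hFS : ∀ {Q}, Q ∈ F → Q ∈ S := fun hQ => (Finset.mem_filter.1 hQ).1
    have key : ∀ Q ∈ F, W Q ≤ ENNReal.ofReal (2 / τ) * ∫⁻ x in Q, g x ∂ω := by
      intro Q hQ
      have h1 : ENNReal.ofReal τ * W Q < ∫⁻ x in Q, h x ∂ω :=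
        (ENNReal.lt_div_iff_mul_lt (Or.inl (hW0 Q (hFS hQ))) (Or.inl (hWt Q (hFS hQ)))).1
          (Finset.mem_filter.1 hQ).2
      have h2 : ∫⁻ x in Q, h x ∂ω ≤ ENNReal.ofReal (τ / 2) * W Q + ∫⁻ x in Q, g x ∂ω := by
        calc ∫⁻ x in Q, h x ∂ω ≤ ∫⁻ x in Q, (ENNReal.ofReal (τ / 2) + g x) ∂ω := by
              refine lintegral_mono fun x => ?_
              by_cases hx : ENNReal.ofReal (τ / 2) < h x
              · have : g x = h x := by rw [hg]; exact indicator_of_mem (s := {x | ENNReal.ofReal (τ / 2) < h x}) hx _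
                rw [this]; exact le_add_self
              · exact (not_lt.1 hx).trans le_self_add
          _ = ENNReal.ofReal (τ / 2) * ω Q + ∫⁻ x in Q, g x ∂ω := by
              rw [lintegral_add_left measurable_const]; simp
          _ ≤ _ := by gcongr; exact hW Q (hFS hQ)
      have hfin : ENNReal.ofReal (τ / 2) * W Q ≠ ∞ :=
        ENNReal.mul_ne_top ENNReal.ofReal_ne_top (hWt Q (hFS hQ))
      have h3 : ENNReal.ofReal (τ / 2) * W Q ≤ ∫⁻ x in Q, g x ∂ω := by
        have h4 := h1.le.trans h2
        rw [show ENNReal.ofReal τ = ENNReal.ofReal (τ / 2) + ENNReal.ofReal (τ / 2) by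
          rw [← ENNReal.ofReal_add (by positivity) (by positivity)]; ring_nf, add_mul] at h4
        exact (ENNReal.add_le_add_iff_left hfin).1 h4
      calc W Q = ENNReal.ofReal (2 / τ) * (ENNReal.ofReal (τ / 2) * W Q) := by
            rw [← mul_assoc, ← ENNReal.ofReal_mul (by positivity)]
            rw [show 2 / τ * (τ / 2) = 1 by field_simp]; simp
        _ ≤ _ := by gcongr
    calc ∑ Q ∈ F, c Q ≤ ∑ R ∈ F with (∀ Q ∈ F, R ⊆ Q → R = Q), ∑ Q ∈ F with Q ⊆ R, c Q :=
          sum_maximal_le F c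
      _ ≤ ∑ R ∈ F with (∀ Q ∈ F, R ⊆ Q → R = Q),
            A * (ENNReal.ofReal (2 / τ) * ∫⁻ x in R, g x ∂ω) := by
          refine Finset.sum_le_sum fun R hR => ?_
          have hRF := (Finset.mem_filter.1 hR).1
          refine le_trans ?_ ((hA R (hFS hRF)).trans (mul_le_mul_right (key R hRF) A))
          exact Finset.sum_le_sum_of_subset
            (Finset.filter_subset_filter _ (Finset.filter_subset _ _))
      _ = A * (ENNReal.ofReal (2 / τ) *
            ∑ R ∈ F with (∀ Q ∈ F, R ⊆ Q → R = Q), ∫⁻ x in R, g x ∂ω) := by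
          rw [← Finset.mul_sum, ← Finset.mul_sum]
      _ ≤ _ := by
          gcongr
          rw [← lintegral_biUnion_finset]
          · exact setLIntegral_le_lintegral _ _
          · intro R hR R' hR' hne
            simp only [Finset.coe_filter, mem_ofPred_eq] at hR hR'
            rcases hlam R (hFS hR.1) R' (hFS hR'.1) with h' | h' | h'
            · exact absurd (hR.2 R' hR'.1 h') hne
            · exact absurd (hR'.2 R hR.1 h').symm hne
            · exact h'
          · intro R hR
            exact hmeas R (hFS (Finset.mem_filter.1 hR).1)
  -- integration over the levels
  have hind : Measurable fun p : ℝ × α => {p : ℝ × α | ENNReal.ofReal (p.1 / 2) < h p.2}.indicator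
      (fun p => ENNReal.ofReal (t * p.1 ^ (t - 1)) * ENNReal.ofReal (2 / p.1) * h p.2) p := by
    refine Measurable.indicator ?_ ?_
    · have := hm.comp (measurable_snd : Measurable fun p : ℝ × α => p.2)
      fun_prop
    · exact measurableSet_lt (by fun_prop) (by fun_prop)
  have hmτ : ∀ a : ℝ≥0∞, MeasurableSet {τ : ℝ | ENNReal.ofReal τ < a} := fun a =>
    measurableSet_lt ENNReal.measurable_ofReal measurable_const
  calc ∑ Q ∈ S, c Q * a Q ^ t
      = ∑ Q ∈ S, ∫⁻ τ in Ioi (0 : ℝ), c Q * {τ : ℝ | ENNReal.ofReal τ < a Q}.indicator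
          (fun τ => ENNReal.ofReal (t * τ ^ (t - 1))) τ := by
        refine Finset.sum_congr rfl fun Q _ => ?_
        rw [lintegral_const_mul _ (Measurable.indicator (by fun_prop) (hmτ _)),
          lintegral_layer ht0]
    _ = ∫⁻ τ in Ioi (0 : ℝ), ∑ Q ∈ S, c Q * {τ : ℝ | ENNReal.ofReal τ < a Q}.indicator
          (fun τ => ENNReal.ofReal (t * τ ^ (t - 1))) τ := by
        rw [lintegral_finsetSum]
        intro Q _
        exact (Measurable.indicator (by fun_prop) (hmτ _)).const_mul _
    _ ≤ ∫⁻ τ in Ioi (0 : ℝ), A * ∫⁻ x, {p : ℝ × α | ENNReal.ofReal (p.1 / 2) < h p.2}.indicator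
          (fun p => ENNReal.ofReal (t * p.1 ^ (t - 1)) * ENNReal.ofReal (2 / p.1) * h p.2)
            (τ, x) ∂ω := by
        refine setLIntegral_mono' measurableSet_Ioi fun τ hτ => ?_
        have e : ∑ Q ∈ S, c Q * {τ : ℝ | ENNReal.ofReal τ < a Q}.indicator
            (fun τ => ENNReal.ofReal (t * τ ^ (t - 1))) τ =
            ENNReal.ofReal (t * τ ^ (t - 1)) * ∑ Q ∈ S with ENNReal.ofReal τ < a Q, c Q := by
          rw [Finset.sum_filter, Finset.mul_sum]
          refine Finset.sum_congr rfl fun Q _ => ?_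
          by_cases hQ : ENNReal.ofReal τ < a Q
          · simp [indicator, hQ, mul_comm]
          · simp [indicator, hQ]
        rw [e]
        refine (mul_le_mul_right (weak τ hτ) _).trans (le_of_eq ?_)
        have e2 : ∀ x, {p : ℝ × α | ENNReal.ofReal (p.1 / 2) < h p.2}.indicator
            (fun p => ENNReal.ofReal (t * p.1 ^ (t - 1)) * ENNReal.ofReal (2 / p.1) * h p.2)
            (τ, x) = ENNReal.ofReal (t * τ ^ (t - 1)) * ENNReal.ofReal (2 / τ) *
              {x | ENNReal.ofReal (τ / 2) < h x}.indicator h x := fun x => by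
          by_cases hx : ENNReal.ofReal (τ / 2) < h x <;> simp [indicator, hx]
        simp only [e2]
        rw [lintegral_const_mul _ (hm.indicator (measurableSet_lt measurable_const hm))]
        ring
    _ = A * ∫⁻ x, (∫⁻ τ in Ioi (0 : ℝ),
          {p : ℝ × α | ENNReal.ofReal (p.1 / 2) < h p.2}.indicator
          (fun p => ENNReal.ofReal (t * p.1 ^ (t - 1)) * ENNReal.ofReal (2 / p.1) * h p.2)
            (τ, x)) ∂ω := by
        rw [lintegral_const_mul _ hind.lintegral_prod_right', lintegral_lintegral_swap hind.aemeasurable]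
    _ = A * ∫⁻ x, ENNReal.ofReal (2 ^ t * (t / (t - 1))) * h x ^ t ∂ω := by
        congr 1
        refine lintegral_congr fun x => ?_
        have e : ∫⁻ τ in Ioi (0 : ℝ), {p : ℝ × α | ENNReal.ofReal (p.1 / 2) < h p.2}.indicator
          (fun p => ENNReal.ofReal (t * p.1 ^ (t - 1)) * ENNReal.ofReal (2 / p.1) * h p.2) (τ, x)
            = ∫⁻ τ in Ioi (0 : ℝ), (ENNReal.ofReal (2 * (t / (t - 1))) * h x) *
              {τ : ℝ | ENNReal.ofReal τ < 2 * h x}.indicator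
                (fun τ => ENNReal.ofReal ((t - 1) * τ ^ (t - 1 - 1))) τ := by
          refine setLIntegral_congr_fun measurableSet_Ioi fun τ hτ => ?_
          have hτ' : (0 : ℝ) < τ := hτ
          have hiff : ENNReal.ofReal (τ / 2) < h x ↔ ENNReal.ofReal τ < 2 * h x := by
            rw [ENNReal.ofReal_div_of_pos two_pos, ENNReal.ofReal_ofNat,
              ENNReal.div_lt_iff (Or.inl two_ne_zero) (Or.inl (by simp)), mul_comm]
          by_cases hx : ENNReal.ofReal τ < 2 * h x
          · have hx' := hiff.2 hx
            simp only [indicator, mem_ofPred_eq, hx, hx', if_true]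
            have ht1 : 0 < t - 1 := by linarith
            have : ENNReal.ofReal (t * τ ^ (t - 1)) * ENNReal.ofReal (2 / τ) =
                ENNReal.ofReal (2 * (t / (t - 1))) *
                  ENNReal.ofReal ((t - 1) * τ ^ (t - 1 - 1)) := by
              rw [← ENNReal.ofReal_mul (by positivity), ← ENNReal.ofReal_mul (by positivity),
                Real.rpow_sub_one hτ'.ne' (t - 1)]
              congr 1; field_simp
            rw [this]; ring
          · have hx' : ¬ ENNReal.ofReal (τ / 2) < h x := fun h' => hx (hiff.1 h')
            simp [indicator, hx, hx']
        rw [e, lintegral_const_mul _ (Measurable.indicator (by fun_prop) (hmτ _)),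
          lintegral_layer (by linarith)]
        have ht1 : 0 < t - 1 := by linarith
        rw [ENNReal.mul_rpow_of_nonneg _ _ ht1.le]
        have e3 : h x * h x ^ (t - 1) = h x ^ t := by
          nth_rw 1 [← ENNReal.rpow_one (h x)]
          rw [← ENNReal.rpow_add_of_nonneg _ _ zero_le_one ht1.le]; ring_nf
        have e4 : ENNReal.ofReal (2 * (t / (t - 1))) * 2 ^ (t - 1) =
            ENNReal.ofReal (2 ^ t * (t / (t - 1))) := by
          rw [← ENNReal.ofReal_ofNat 2, ENNReal.ofReal_rpow_of_pos two_pos,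
            ← ENNReal.ofReal_mul (by positivity)]
          rw [Real.rpow_sub_one two_ne_zero]; congr 1; field_simp
        rw [← e3, ← e4]; ring
    _ = _ := by rw [lintegral_const_mul _ (by fun_prop)]

/-! ### Representation of functionals on `L^q` -/

open Filter Topology

section Riesz

variable {α : Type*} [MeasurableSpace α] {𝕜 : Type*} [RCLike 𝕜]

theorem sum_indicatorConstLp (ω : Measure α) [IsFiniteMeasure ω] (q : ℝ≥0∞)
    {f : ℕ → Set α} (hf : ∀ i, MeasurableSet (f i)) (hd : Pairwise (Function.onFun Disjoint f))
    (F : Finset ℕ) :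
    ∑ i ∈ F, indicatorConstLp q (hf i) (measure_ne_top ω _) (1 : 𝕜) =
      indicatorConstLp q (F.measurableSet_biUnion fun i _ => hf i) (measure_ne_top ω _) (1 : 𝕜) := by
  classical
  induction F using Finset.induction_on with
  | empty => simp
  | insert j F hj ih =>
    rw [Finset.sum_insert hj, ih]
    have hdis : Disjoint (f j) (⋃ i ∈ F, f i) := by
      rw [disjoint_iUnion₂_right]
      intro i hi
      exact hd fun h => hj (h ▸ hi)
    rw [← indicatorConstLp_disjoint_union (hf j) (F.measurableSet_biUnion fun i _ => hf i)
      (measure_ne_top ω _) (measure_ne_top ω _) hdis]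
    congr 1
    simp

theorem hasSum_indicatorConstLp (ω : Measure α) [IsFiniteMeasure ω] {q : ℝ≥0∞} [Fact (1 ≤ q)]
    (hq : q ≠ ∞) {f : ℕ → Set α} (hf : ∀ i, MeasurableSet (f i))
    (hd : Pairwise (Function.onFun Disjoint f)) :
    HasSum (fun i => indicatorConstLp q (hf i) (measure_ne_top ω _) (1 : 𝕜))
      (indicatorConstLp q (MeasurableSet.iUnion hf) (measure_ne_top ω _) (1 : 𝕜)) := by
  unfold HasSum
  simp only [sum_indicatorConstLp ω q hf hd]
  refine tendsto_indicatorConstLp_set hq ?_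
  have hs : HasSum (fun i => ω (f i)) (ω (⋃ i, f i)) := by
    rw [measure_iUnion hd hf]; exact ENNReal.summable.hasSum
  have h1 : Tendsto (fun F : Finset ℕ => ω (⋃ i, f i) - ∑ i ∈ F, ω (f i)) atTop (𝓝 0) := by
    have := ENNReal.Tendsto.sub (tendsto_const_nhds (x := ω (⋃ i, f i)) (f := atTop)) hs
      (Or.inl (measure_ne_top ω _))
    simpa using this
  refine h1.congr fun F => ?_
  have hsub : (⋃ i ∈ F, f i) ⊆ ⋃ i, f i := iUnion₂_subset fun i _ => subset_iUnion f i
  rw [Set.symmDiff_def, sdiff_eq_empty.2 hsub, empty_union,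
    measure_sdiff hsub (F.measurableSet_biUnion fun i _ => hf i).nullMeasurableSet
      (measure_ne_top ω _), measure_biUnion_finset (fun i _ j _ h => hd h) fun i _ => hf i]

theorem exists_real_density (ω : Measure α) [IsFiniteMeasure ω] {q : ℝ≥0∞} [Fact (1 ≤ q)]
    (hq : q ≠ ∞) (Φ : Lp 𝕜 q ω →+ ℝ) (hΦ : Continuous Φ) :
    ∃ k : α → ℝ, Measurable k ∧ Integrable k ω ∧ ∀ E (hE : MeasurableSet E),
      Φ (indicatorConstLp q hE (measure_ne_top ω _) (1 : 𝕜)) = ∫ x in E, k x ∂ω := by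
  classical
  let s : SignedMeasure α :=
    { measureOf' := fun E => if hE : MeasurableSet E then
        Φ (indicatorConstLp q hE (measure_ne_top ω _) (1 : 𝕜)) else 0
      empty' := by simp
      not_measurable' := fun E hE => dif_neg hE
      m_iUnion' := fun f hf hd => by
        simp only [hf, MeasurableSet.iUnion hf, dif_pos]
        exact (hasSum_indicatorConstLp ω hq hf hd).map Φ hΦ }
  have hsE : ∀ E (hE : MeasurableSet E), s E =
      Φ (indicatorConstLp q hE (measure_ne_top ω _) (1 : 𝕜)) := fun E hE => dif_pos hE
  have hac : s ≪ᵥ ω.toENNRealVectorMeasure := by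
    refine VectorMeasure.AbsolutelyContinuous.mk fun E hE h0 => ?_
    rw [Measure.toENNRealVectorMeasure_apply_measurable hE] at h0
    rw [hsE E hE]
    have : indicatorConstLp q hE (measure_ne_top ω _) (1 : 𝕜) = 0 := by
      rw [← norm_eq_zero, norm_indicatorConstLp (one_pos.trans_le (Fact.out : 1 ≤ q)).ne' hq]
      rw [measureReal_def, h0]
      have : 0 < q.toReal := ENNReal.toReal_pos (one_pos.trans_le (Fact.out : 1 ≤ q)).ne' hq
      simp [this.ne']
    rw [this, map_zero]
  refine ⟨s.rnDeriv ω, SignedMeasure.measurable_rnDeriv s ω, SignedMeasure.integrable_rnDeriv s ω,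
    fun E hE => ?_⟩
  rw [← hsE E hE, ← withDensityᵥ_apply (SignedMeasure.integrable_rnDeriv s ω) hE,
    SignedMeasure.withDensityᵥ_rnDeriv_eq s ω hac]

theorem exists_density (ω : Measure α) [IsFiniteMeasure ω] {q : ℝ≥0∞} [Fact (1 ≤ q)]
    (hq : q ≠ ∞) (Φ : StrongDual 𝕜 (Lp 𝕜 q ω)) :
    ∃ k : α → 𝕜, Measurable k ∧ Integrable k ω ∧ ∀ E (hE : MeasurableSet E),
      Φ (indicatorConstLp q hE (measure_ne_top ω _) (1 : 𝕜)) = ∫ x in E, k x ∂ω := by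
  obtain ⟨k₁, m₁, i₁, h₁⟩ := exists_real_density ω hq
    ((RCLike.re : 𝕜 →+ ℝ).comp Φ.toLinearMap.toAddMonoidHom) (RCLike.continuous_re.comp Φ.continuous)
  obtain ⟨k₂, m₂, i₂, h₂⟩ := exists_real_density ω hq
    ((RCLike.im : 𝕜 →+ ℝ).comp Φ.toLinearMap.toAddMonoidHom) (RCLike.continuous_im.comp Φ.continuous)
  refine ⟨fun x => (k₁ x : 𝕜) + (k₂ x : 𝕜) * RCLike.I, by fun_prop,
    i₁.ofReal.add (i₂.ofReal.mul_const _), fun E hE => ?_⟩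
  have a₁ : Integrable (fun x => (k₁ x : 𝕜)) (ω.restrict E) := i₁.ofReal.integrableOn
  have a₂ : Integrable (fun x => (k₂ x : 𝕜) * RCLike.I) (ω.restrict E) :=
    (i₂.ofReal.mul_const _).integrableOn
  change _ = ∫ x in E, ((k₁ x : 𝕜) + (k₂ x : 𝕜) * RCLike.I) ∂ω
  rw [integral_add a₁ a₂, integral_mul_const, integral_ofReal, integral_ofReal, ← h₁ E hE, ← h₂ E hE]
  exact (RCLike.re_add_im _).symm

theorem apply_eq_integral {ω : Measure α} [IsFiniteMeasure ω] {q : ℝ≥0∞} [Fact (1 ≤ q)]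
    (hq : q ≠ ∞) {Φ : StrongDual 𝕜 (Lp 𝕜 q ω)} {k : α → 𝕜} (hk : Integrable k ω)
    (h : ∀ E (hE : MeasurableSet E),
      Φ (indicatorConstLp q hE (measure_ne_top ω _) (1 : 𝕜)) = ∫ x in E, k x ∂ω)
    {g : α → 𝕜} (hg : MemLp g q ω) (hkg : Integrable (fun x => k x * g x) ω) :
    Φ (hg.toLp g) = ∫ x, k x * g x ∂ω := by
  -- simple functions
  have hsimple : ∀ (φ : SimpleFunc α 𝕜) (hφ : MemLp φ q ω), Integrable (fun x => k x * φ x) ω ∧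
      Φ (hφ.toLp φ) = ∫ x, k x * φ x ∂ω := by
    intro φ
    induction φ using SimpleFunc.induction with
    | const c hs =>
      rename_i s
      intro hφ
      have e1 : (fun x => k x * (SimpleFunc.piecewise s hs (SimpleFunc.const α c)
          (SimpleFunc.const α 0)) x) = s.indicator fun x => k x * c := by
        ext x
        by_cases hx : x ∈ s <;> simp [hx]
      have e2 : hφ.toLp _ = c • indicatorConstLp q hs (measure_ne_top ω s) (1 : 𝕜) := by
        rw [indicatorConstLp, ← MemLp.toLp_const_smul]
        refine MemLp.toLp_congr _ _ (Eventually.of_forall fun x => ?_)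
        by_cases hx : x ∈ s <;> simp [hx]
      refine ⟨by rw [e1]; exact (hk.mul_const c).indicator hs, ?_⟩
      rw [e1, integral_indicator hs, integral_mul_const, e2, map_smul, h s hs, smul_eq_mul,
        mul_comm]
    | add hd h₁ h₂ =>
      rename_i f₁ f₂
      intro hφ
      have hφ' := (memLp_add_of_disjoint (by simpa using hd) f₁.stronglyMeasurable
        f₂.stronglyMeasurable).1 (by simpa using hφ)
      obtain ⟨i₁, e₁⟩ := h₁ hφ'.1
      obtain ⟨i₂, e₂⟩ := h₂ hφ'.2
      refine ⟨by simpa [mul_add] using! i₁.add i₂, ?_⟩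
      have e3 : hφ.toLp _ = hφ'.1.toLp f₁ + hφ'.2.toLp f₂ := by
        rw [← MemLp.toLp_add]
        exact MemLp.toLp_congr _ _ (Eventually.of_forall fun x => by simp)
      rw [e3, map_add, e₁, e₂, ← integral_add i₁ i₂]
      simp [mul_add]
  -- reduction to measurable functions
  wlog hm : Measurable g generalizing g
  · have hae := hg.1.aemeasurable.ae_eq_mk
    have hg' := (memLp_congr_ae hae).1 hg
    have hae' : (fun x => k x * g x) =ᵐ[ω] fun x => k x * hg.1.aemeasurable.mk g x :=
      hae.mono fun x hx => by simp only [hx]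
    rw [MemLp.toLp_congr hg hg' hae, integral_congr_ae hae']
    exact this hg' ((integrable_congr hae').1 hkg) hg.1.aemeasurable.measurable_mk
  have h1 := (Φ.continuous.tendsto _).comp (SimpleFunc.tendsto_approxOn_range_Lp hq hm hg)
  refine tendsto_nhds_unique h1 ?_
  have e : ∀ j, (Φ ∘ fun j => (SimpleFunc.memLp_approxOn_range hm hg j).toLp
      (SimpleFunc.approxOn g hm (range g ∪ {0}) 0 (by simp) j)) j =
      ∫ x, k x * SimpleFunc.approxOn g hm (range g ∪ {0}) 0 (by simp) j x ∂ω :=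
    fun j => (hsimple _ _).2
  rw [show (Φ ∘ fun j => (SimpleFunc.memLp_approxOn_range hm hg j).toLp
      (SimpleFunc.approxOn g hm (range g ∪ {0}) 0 (by simp) j)) = _ from funext e]
  refine tendsto_integral_of_dominated_convergence (fun x => 2 * ‖k x * g x‖)
    (fun j => (hsimple _ (SimpleFunc.memLp_approxOn_range hm hg j)).1.1) (hkg.norm.const_mul 2)
    (fun j => Eventually.of_forall fun x => ?_) (Eventually.of_forall fun x => ?_)
  · rw [norm_mul, norm_mul]
    have := SimpleFunc.norm_approxOn_zero_le hm (s := range g ∪ {0}) (by simp) x j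
    have := mul_le_mul_of_nonneg_left this (norm_nonneg (k x))
    linarith
  · exact (SimpleFunc.tendsto_approxOn hm _ (subset_closure (by simp))).const_mul _

theorem lintegral_density_le {ω : Measure α} [IsFiniteMeasure ω] {P q : ℝ}
    (hPq : P.HolderConjugate q) [Fact (1 ≤ ENNReal.ofReal q)]
    {Φ : StrongDual 𝕜 (Lp 𝕜 (ENNReal.ofReal q) ω)} {k : α → 𝕜} (hkm : Measurable k)
    (hk : Integrable k ω)
    (h : ∀ E (hE : MeasurableSet E),
      Φ (indicatorConstLp (ENNReal.ofReal q) hE (measure_ne_top ω _) (1 : 𝕜)) = ∫ x in E, k x ∂ω) :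
    ∫⁻ x, ‖k x‖ₑ ^ P ∂ω ≤ ‖Φ‖ₑ ^ P := by
  have hP := hPq.pos
  have hq := hPq.symm.pos
  have hmN : ∀ N : ℕ, MeasurableSet {x | ‖k x‖ ≤ N} := fun N =>
    measurableSet_le hkm.norm measurable_const
  have key : ∀ N : ℕ, ∫⁻ x in {x | ‖k x‖ ≤ N}, ‖k x‖ₑ ^ P ∂ω ≤ ‖Φ‖ₑ ^ P := by
    intro N
    set s := {x | ‖k x‖ ≤ (N : ℝ)} with hs
    have hms : MeasurableSet s := hmN N
    set J := ∫⁻ x in s, ‖k x‖ₑ ^ P ∂ω with hJ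
    set ψ : α → 𝕜 := s.indicator fun x => ((‖k x‖ ^ (P - 2) : ℝ) : 𝕜) * (starRingEnd 𝕜) (k x)
      with hψ
    have hψm : Measurable ψ := by
      refine Measurable.indicator ?_ hms
      have : Measurable fun x => (starRingEnd 𝕜) (k x) := RCLike.continuous_conj.measurable.comp hkm
      fun_prop
    have hmul : ∀ x, k x * ψ x = ((s.indicator (fun x => ‖k x‖ ^ P) x : ℝ) : 𝕜) := by
      intro x
      by_cases hx : x ∈ s
      · simp only [hψ, indicator_of_mem hx]
        rw [mul_left_comm, RCLike.mul_conj, ← RCLike.ofReal_pow, ← RCLike.ofReal_mul]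
        rcases eq_or_ne (k x) 0 with h0 | h0
        · simp [h0, hP.ne']
        · rw [← Real.rpow_natCast, ← Real.rpow_add (norm_pos_iff.2 h0)]; norm_num
      · simp [hψ, hx]
    have hnorm : ∀ x, ‖ψ x‖ = s.indicator (fun x => ‖k x‖ ^ (P - 1)) x := by
      intro x
      by_cases hx : x ∈ s
      · simp only [hψ, indicator_of_mem hx]
        rw [norm_mul, RCLike.norm_conj, RCLike.norm_ofReal, abs_of_nonneg (by positivity)]
        rcases eq_or_ne (k x) 0 with h0 | h0
        · simp [h0, hPq.sub_one_ne_zero]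
        · rw [← Real.rpow_add_one (norm_ne_zero_iff.2 h0)]; ring_nf
      · simp [hψ, hx]
    have hbound : ∀ x, ‖ψ x‖ ≤ (N : ℝ) ^ (P - 1) := by
      intro x
      rw [hnorm]
      by_cases hx : x ∈ s
      · rw [indicator_of_mem hx]
        exact Real.rpow_le_rpow (norm_nonneg _) hx hPq.sub_one_pos.le
      · rw [indicator_of_notMem hx]; positivity
    have hψL : MemLp ψ (ENNReal.ofReal q) ω :=
      MemLp.of_bound hψm.aestronglyMeasurable _ (Eventually.of_forall hbound)
    have hkψ : Integrable (fun x => k x * ψ x) ω :=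
      hk.mul_bdd hψm.aestronglyMeasurable (Eventually.of_forall hbound)
    have h1 : Φ (hψL.toLp ψ) = ∫ x, k x * ψ x ∂ω :=
      apply_eq_integral ENNReal.ofReal_ne_top hk h hψL hkψ
    have hJψ : ∫⁻ x, ‖ψ x‖ₑ ^ q ∂ω = J := by
      rw [hJ, ← lintegral_indicator hms]
      refine lintegral_congr fun x => ?_
      rw [← ofReal_norm (ψ x), hnorm]
      by_cases hx : x ∈ s
      · rw [indicator_of_mem hx, indicator_of_mem hx, ← ofReal_norm,
          ENNReal.ofReal_rpow_of_nonneg (by positivity) hq.le,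
          ENNReal.ofReal_rpow_of_nonneg (by positivity) hP.le, ← Real.rpow_mul (norm_nonneg _),
          hPq.sub_one_mul_conj]
      · simp [hx, hq]
    have hJk : J = ‖∫ x, k x * ψ x ∂ω‖ₑ := by
      simp_rw [hmul]
      rw [integral_ofReal, ← ofReal_norm, RCLike.norm_ofReal, abs_of_nonneg
        (integral_nonneg fun x => indicator_nonneg (fun x _ => by positivity) x),
        ofReal_integral_eq_lintegral_ofReal]
      · rw [hJ, ← lintegral_indicator hms]
        refine lintegral_congr fun x => ?_
        by_cases hx : x ∈ s
        · rw [indicator_of_mem hx, indicator_of_mem hx, ← ofReal_norm,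
            ENNReal.ofReal_rpow_of_nonneg (by positivity) hP.le]
        · simp [hx]
      · have := hkψ.re
        simpa only [hmul, RCLike.ofReal_re] using! this
      · exact Eventually.of_forall fun x => indicator_nonneg (fun x _ => by positivity) x
    have hJfin : J ≠ ∞ := by rw [hJk]; exact enorm_ne_top
    have h2 : J ≤ ‖Φ‖ₑ * J ^ (1 / q) := by
      calc J = ‖Φ (hψL.toLp ψ)‖ₑ := by rw [h1, hJk]
        _ ≤ ‖Φ‖ₑ * ‖hψL.toLp ψ‖ₑ := Φ.le_opENorm _
        _ = ‖Φ‖ₑ * J ^ (1 / q) := by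
          rw [Lp.enorm_toLp, eLpNorm_eq_lintegral_rpow_enorm_toReal (by simpa using hq)
            ENNReal.ofReal_ne_top, ENNReal.toReal_ofReal hq.le, hJψ]
    rcases eq_or_ne J 0 with h0 | h0
    · rw [h0]; exact zero_le
    have h3 : J ^ (1 / P) ≤ ‖Φ‖ₑ := by
      have e : J = J ^ (1 / P) * J ^ (1 / q) := by
        rw [← ENNReal.rpow_add _ _ h0 hJfin, one_div, one_div, hPq.inv_add_inv_eq_one,
          ENNReal.rpow_one]
      have hne : J ^ (1 / q) ≠ 0 := by simp [ENNReal.rpow_eq_zero_iff, h0, hJfin]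
      have hnt : J ^ (1 / q) ≠ ∞ := by simp [ENNReal.rpow_eq_top_iff, h0, hJfin]
      nth_rw 1 [e] at h2
      exact (ENNReal.mul_le_mul_iff_left hne hnt).1 h2
    calc J = (J ^ (1 / P)) ^ P := by rw [← ENNReal.rpow_mul, one_div_mul_cancel hP.ne', ENNReal.rpow_one]
      _ ≤ _ := ENNReal.rpow_le_rpow h3 hP.le
  have hmono : Monotone fun N : ℕ => {x | ‖k x‖ ≤ (N : ℝ)} := fun N M hNM x hx =>
    le_trans (show ‖k x‖ ≤ N from hx) (by exact_mod_cast hNM)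
  have hU : (⋃ N : ℕ, {x | ‖k x‖ ≤ (N : ℝ)}) = univ :=
    eq_univ_of_forall fun x => mem_iUnion.2 (exists_nat_ge ‖k x‖)
  rw [← setLIntegral_univ, ← hU, setLIntegral_iUnion_of_directed _ hmono.directed_le]
  exact iSup_le key

/-- A functional on a space of functions that is bounded by an `L^q` norm is given by integration
against an `L^P` function. -/
theorem exists_representation {E : Type*} [AddCommGroup E] [Module 𝕜 E] {ω : Measure α}
    [IsFiniteMeasure ω] {P q : ℝ} (hPq : P.HolderConjugate q) [Fact (1 ≤ ENNReal.ofReal q)]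
    (J : E →ₗ[𝕜] Lp 𝕜 (ENNReal.ofReal q) ω) (L : E →ₗ[𝕜] 𝕜) (K : ℝ) (hK : 0 ≤ K)
    (hL : ∀ g, ‖L g‖ ≤ K * ‖J g‖) :
    ∃ k : α → 𝕜, Measurable k ∧ ∫⁻ x, ‖k x‖ₑ ^ P ∂ω ≤ ENNReal.ofReal K ^ P ∧
      ∀ g, Integrable (fun x => k x * J g x) ω ∧ L g = ∫ x, k x * J g x ∂ω := by
  have hker : LinearMap.ker J ≤ LinearMap.ker L := fun g hg => by
    rw [LinearMap.mem_ker] at hg ⊢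
    have := hL g
    rw [hg, norm_zero, mul_zero] at this
    exact norm_le_zero_iff.1 this
  let ℓ : LinearMap.range J →ₗ[𝕜] 𝕜 := (LinearMap.ker J).liftQ L hker ∘ₗ
    J.quotKerEquivRange.symm.toLinearMap
  have hℓ : ∀ g, ℓ ⟨J g, LinearMap.mem_range_self J g⟩ = L g := fun g => by
    simp only [ℓ, LinearMap.comp_apply, LinearEquiv.coe_coe]
    rw [show (⟨J g, LinearMap.mem_range_self J g⟩ : LinearMap.range J) =
      J.quotKerEquivRange (Submodule.Quotient.mk g) from Subtype.ext (by simp),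
      LinearEquiv.symm_apply_apply, ← Submodule.mkQ_apply]
    exact Submodule.liftQ_apply _ _ _
  have hb : ∀ y, ‖ℓ y‖ ≤ K * ‖y‖ := by
    rintro ⟨_, g, rfl⟩
    rw [hℓ]
    exact hL g
  obtain ⟨Φ, hΦ, hn⟩ := exists_extension_norm_eq (LinearMap.range J) (ℓ.mkContinuous K hb)
  obtain ⟨k, hkm, hki, hkE⟩ := exists_density ω ENNReal.ofReal_ne_top Φ
  have hkP := lintegral_density_le hPq hkm hki hkE
  have hΦK : ‖Φ‖ ≤ K := hn.trans_le (LinearMap.mkContinuous_norm_le _ hK _)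
  have hΦK' : ‖Φ‖ₑ ^ P ≤ ENNReal.ofReal K ^ P := by
    refine ENNReal.rpow_le_rpow ?_ hPq.pos.le
    rw [← ofReal_norm]
    exact ENNReal.ofReal_le_ofReal hΦK
  refine ⟨k, hkm, hkP.trans hΦK', fun g => ?_⟩
  have hkL : MemLp k (ENNReal.ofReal P) ω := by
    refine ⟨hkm.aestronglyMeasurable, ?_⟩
    rw [eLpNorm_lt_top_iff_lintegral_rpow_enorm_lt_top (by simpa using hPq.pos) ENNReal.ofReal_ne_top,
      ENNReal.toReal_ofReal hPq.pos.le]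
    exact (hkP.trans hΦK').trans_lt (ENNReal.rpow_lt_top_of_nonneg hPq.pos.le ENNReal.ofReal_ne_top)
  have : ENNReal.HolderConjugate (ENNReal.ofReal P) (ENNReal.ofReal q) := hPq.ennrealOfReal
  have hint : Integrable (fun x => k x * J g x) ω := hkL.integrable_mul (Lp.memLp (J g))
  have := apply_eq_integral ENNReal.ofReal_ne_top hki hkE (Lp.memLp (J g)) hint
  rw [Lp.toLp_coeFn] at this
  refine ⟨hint, ?_⟩
  rw [← this]
  have h2 := hΦ ⟨J g, LinearMap.mem_range_self J g⟩
  rw [LinearMap.mkContinuous_apply, hℓ] at h2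
  exact h2.symm

end Riesz

/-! ### Averages and cubes -/

theorem IsDoubling.isLocallyFiniteMeasure {n : ℕ} {μ : Measure (Rn n)} (hμ : IsDoubling μ) :
    IsLocallyFiniteMeasure μ :=
  ⟨fun x => ⟨Metric.ball x 1, Metric.ball_mem_nhds x one_pos, hμ.ball_lt_top x 1 one_pos⟩⟩

theorem IsDoubling.cube_ne_zero {n : ℕ} {μ : Measure (Rn n)} (hμ : IsDoubling μ) {Q : Set (Rn n)}
    (hQ : Q ∈ dyadicCubes n) : μ Q ≠ 0 := by
  obtain ⟨a, k, m, rfl⟩ := mem_iUnion.1 hQ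
  exact ((hμ.ball_pos _ _ (by positivity)).trans_le
    (measure_mono (ball_center_subset a k m))).ne'

theorem cube_subset_ball {n : ℕ} {Q : Set (Rn n)} (hQ : Q ∈ dyadicCubes n) :
    ∃ (y : Rn n) (r : ℝ), 0 < r ∧ Q ⊆ Metric.ball y r := by
  obtain ⟨a, k, m, rfl⟩ := mem_iUnion.1 hQ
  refine ⟨center a k m, √n * ((2 : ℝ) ^ (-k) / 2) + 1, by positivity, fun x hx => ?_⟩
  rw [mem_ball_iff_norm]
  linarith [norm_sub_center_le hx]

theorem IsDoubling.cube_ne_top {n : ℕ} {μ : Measure (Rn n)} (hμ : IsDoubling μ) {Q : Set (Rn n)}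
    (hQ : Q ∈ dyadicCubes n) : μ Q ≠ ∞ := by
  obtain ⟨y, r, hr, h⟩ := cube_subset_ball hQ
  exact ((measure_mono h).trans_lt (hμ.ball_lt_top y r hr)).ne

theorem avg_eq {n : ℕ} {F : Type*} [NormedAddCommGroup F] (μ : Measure (Rn n)) (f : Rn n → F)
    {p : ℝ≥0∞} (hp : p ≠ 0) (hp' : p ≠ ∞) (E : Set (Rn n)) :
    avg μ f p E = ((∫⁻ x in E, ‖f x‖ₑ ^ p.toReal ∂μ) / μ E) ^ (1 / p.toReal) := by
  rw [avg, eLpNorm_eq_lintegral_rpow_enorm_toReal hp hp', lintegral_smul_measure, smul_eq_mul,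
    ENNReal.div_eq_inv_mul]

theorem weightMeasure_apply {n : ℕ} (μ : Measure (Rn n)) [SFinite μ] (w : Rn n → ℝ)
    (E : Set (Rn n)) : weightMeasure μ w E = ∫⁻ x in E, ENNReal.ofReal (w x) ∂μ :=
  withDensity_apply' _ _

instance {n : ℕ} (μ : Measure (Rn n)) [SFinite μ] (w : Rn n → ℝ) : SFinite (weightMeasure μ w) :=
  inferInstanceAs (SFinite (μ.withDensity _))

theorem lintegral_weightMeasure {n : ℕ} (μ : Measure (Rn n)) {w : Rn n → ℝ} (hw : IsWeight w)
    (f : Rn n → ℝ≥0∞) :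
    ∫⁻ x, f x ∂weightMeasure μ w = ∫⁻ x, ENNReal.ofReal (w x) * f x ∂μ :=
  lintegral_withDensity_eq_lintegral_mul_non_measurable _ hw.measurable.ennreal_ofReal
    (Filter.Eventually.of_forall fun _ => ENNReal.ofReal_lt_top) _

theorem setLIntegral_weightMeasure {n : ℕ} (μ : Measure (Rn n)) {w : Rn n → ℝ} (hw : IsWeight w)
    (f : Rn n → ℝ≥0∞) {E : Set (Rn n)} (hE : MeasurableSet E) :
    ∫⁻ x in E, f x ∂weightMeasure μ w = ∫⁻ x in E, ENNReal.ofReal (w x) * f x ∂μ :=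
  setLIntegral_withDensity_eq_setLIntegral_mul_non_measurable _ hw.measurable.ennreal_ofReal
    _ hE (Filter.Eventually.of_forall fun _ => ENNReal.ofReal_lt_top)

theorem IsWeight.enorm_eq {n : ℕ} {w : Rn n → ℝ} (hw : IsWeight w) (x : Rn n) :
    ‖w x‖ₑ = ENNReal.ofReal (w x) :=
  Real.enorm_of_nonneg (hw.pos x).le

theorem IsWeight.rpow {n : ℕ} {w : Rn n → ℝ} (hw : IsWeight w) (s : ℝ) :
    IsWeight fun x => w x ^ s :=
  ⟨hw.measurable.pow_const s, fun x => Real.rpow_pos_of_pos (hw.pos x) s⟩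

theorem IsWeight.avg_one {n : ℕ} {μ : Measure (Rn n)} [SFinite μ] {w : Rn n → ℝ}
    (hw : IsWeight w) (E : Set (Rn n)) :
    avg μ w 1 E = weightMeasure μ w E / μ E := by
  rw [avg_eq μ w one_ne_zero ENNReal.one_ne_top, weightMeasure_apply]
  simp [hw.enorm_eq]

theorem IsWeight.avg_rpow {n : ℕ} {μ : Measure (Rn n)} {w : Rn n → ℝ}
    (hw : IsWeight w) {s : ℝ} (hs : 0 < s) (p : ℝ≥0∞) (E : Set (Rn n)) :
    avg μ (fun x => w x ^ s) p E = avg μ w (p * ENNReal.ofReal s) E ^ s := by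
  rw [avg, avg, ← eLpNorm_norm_rpow _ hs]
  simp only [Real.norm_of_nonneg (hw.pos _).le]

theorem IsWeight.weightMeasure_ne_zero {n : ℕ} {μ : Measure (Rn n)} [SFinite μ] {w : Rn n → ℝ}
    (hw : IsWeight w) {E : Set (Rn n)} (hE : μ E ≠ 0) : weightMeasure μ w E ≠ 0 := by
  rw [weightMeasure_apply]
  refine (setLIntegral_pos_iff hw.measurable.ennreal_ofReal).2 ?_ |>.ne'
  have : Function.support (fun x => ENNReal.ofReal (w x)) = univ := by
    ext x; simp [hw.pos x]
  rw [this, univ_inter]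
  exact pos_iff_ne_zero.2 hE

/-! ### The `A₁` condition -/

theorem IsWeight.ae_weightMeasure_le {n : ℕ} {μ : Measure (Rn n)} [SFinite μ]
    (hμ : IsDoubling μ) {v : Rn n → ℝ} (hv : IsWeight v) {Q : Set (Rn n)}
    (hQ : Q ∈ dyadicCubes n) :
    ∀ᵐ x ∂μ.restrict Q, weightMeasure μ v Q ≤ A1Const μ v * μ Q * ENNReal.ofReal (v x) := by
  have h1 : avg μ v 1 Q * avg μ (fun x => (v x)⁻¹) ∞ Q ≤ A1Const μ v :=
    le_iSup₂ (f := fun Q (_ : Q ∈ dyadicCubes n) => avg μ v 1 Q * avg μ (fun x => (v x)⁻¹) ∞ Q) Q hQ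
  have h2 : ∀ᵐ x ∂μ.restrict Q, ‖(v x)⁻¹‖ₑ ≤ avg μ (fun x => (v x)⁻¹) ∞ Q := by
    rw [avg, eLpNorm_exponent_top, eLpNormEssSup_ennreal_smul_measure
      (ENNReal.inv_ne_zero.2 (hμ.cube_ne_top hQ))]
    exact enorm_ae_le_eLpNormEssSup _ _
  filter_upwards [h2] with x hx
  have hx0 : ENNReal.ofReal (v x) ≠ 0 := by simp [hv.pos x]
  have hxe : ‖(v x)⁻¹‖ₑ = (ENNReal.ofReal (v x))⁻¹ := by
    rw [Real.enorm_of_nonneg (inv_pos.2 (hv.pos x)).le, ENNReal.ofReal_inv_of_pos (hv.pos x)]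
  have h3 := (mul_le_mul_right hx (avg μ v 1 Q)).trans h1
  rw [hxe, hv.avg_one, ← div_eq_mul_inv, ENNReal.div_le_iff hx0 ENNReal.ofReal_ne_top,
    ENNReal.div_le_iff (hμ.cube_ne_zero hQ) (hμ.cube_ne_top hQ)] at h3
  calc _ ≤ _ := h3
    _ = _ := by ring

theorem IsWeight.ae_forall_weightMeasure_le {n : ℕ} {μ : Measure (Rn n)} [SFinite μ]
    (hμ : IsDoubling μ) {v : Rn n → ℝ} (hv : IsWeight v) :
    ∀ᵐ x ∂μ, ∀ Q ∈ dyadicCubes n, x ∈ Q →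
      weightMeasure μ v Q ≤ A1Const μ v * μ Q * ENNReal.ofReal (v x) :=
  (ae_ball_iff (countable_dyadicCubes n)).2 fun _ hQ =>
    ae_imp_of_ae_restrict (hv.ae_weightMeasure_le hμ hQ)

theorem IsWeight.cube_ne_top {n : ℕ} {μ : Measure (Rn n)} [SFinite μ]
    (hμ : IsDoubling μ) {v : Rn n → ℝ} (hv : IsWeight v) (hA : A1Const μ v ≠ ∞) {Q : Set (Rn n)}
    (hQ : Q ∈ dyadicCubes n) : weightMeasure μ v Q ≠ ∞ := by
  have h := hv.ae_weightMeasure_le hμ hQ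
  have : (ae (μ.restrict Q)).NeBot := by
    rw [ae_restrict_neBot]; exact hμ.cube_ne_zero hQ
  obtain ⟨x, hx⟩ := h.exists
  refine (hx.trans_lt ?_).ne
  exact ENNReal.mul_lt_top (ENNReal.mul_lt_top hA.lt_top (hμ.cube_ne_top hQ).lt_top)
    ENNReal.ofReal_lt_top

theorem IsWeight.ball_ne_top {n : ℕ} {μ : Measure (Rn n)} [SFinite μ]
    (hμ : IsDoubling μ) {v : Rn n → ℝ} (hv : IsWeight v) (hA : A1Const μ v ≠ ∞)
    (y : Rn n) (r : ℝ) : weightMeasure μ v (Metric.ball y r) ≠ ∞ := by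
  rcases le_or_gt r 0 with hr | hr
  · simp [Metric.ball_eq_empty.2 hr]
  obtain ⟨a, k, m, h, -⟩ := exists_dyadicCube_ball_subset y hr
  exact ((measure_mono h).trans_lt
    (hv.cube_ne_top hμ hA (dyadicGrid_subset a ⟨k, m, rfl⟩)).lt_top).ne

theorem avg_ball_indicator_le {n : ℕ} {μ : Measure (Rn n)} [SFinite μ]
    {v : Rn n → ℝ} (hv : IsWeight v) {B : Set (Rn n)} (hB : MeasurableSet B) (B' : Set (Rn n)) :
    avg μ (B.indicator v) 1 B' = weightMeasure μ v (B ∩ B') / μ B' := by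
  rw [avg_eq μ _ one_ne_zero ENNReal.one_ne_top, weightMeasure_apply]
  simp only [ENNReal.toReal_one, ENNReal.rpow_one, div_one]
  have : ∀ x, ‖B.indicator v x‖ₑ = B.indicator (fun x => ENNReal.ofReal (v x)) x := fun x => by
    by_cases hx : x ∈ B <;> simp [hx, hv.enorm_eq]
  simp_rw [this]
  rw [lintegral_indicator hB, Measure.restrict_restrict hB]

/-- `[v]_{A_∞} ≲ [v]_{A₁}`. -/
theorem IsWeight.aInftyConst_le {n : ℕ} {μ : Measure (Rn n)} [SFinite μ]
    (hμ : IsDoubling μ) {K : ℝ≥0∞} (hK : Comparison μ K) {v : Rn n → ℝ} (hv : IsWeight v) :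
    AInftyConst μ v ≤ K * A1Const μ v := by
  refine iSup_le fun y => iSup_le fun r => iSup_le fun hr => ?_
  refine ENNReal.div_le_of_le_mul ?_
  set B := Metric.ball y r
  have key : ∀ᵐ x ∂μ, ballMaximal μ (B.indicator v) x ≤
      K * A1Const μ v * ENNReal.ofReal (v x) := by
    filter_upwards [hv.ae_forall_weightMeasure_le hμ] with x hx
    refine iSup_le fun z => iSup_le fun t => iSup_le fun ht => iSup_le fun hxt => ?_
    rw [avg_ball_indicator_le hv measurableSet_ball]
    obtain ⟨R, hR, hBR, hRK⟩ := hK.exists_cube z t ht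
    refine ENNReal.div_le_of_le_mul ?_
    calc weightMeasure μ v (B ∩ Metric.ball z t) ≤ weightMeasure μ v R :=
          measure_mono (inter_subset_right.trans hBR)
      _ ≤ A1Const μ v * μ R * ENNReal.ofReal (v x) := hx R hR (hBR hxt)
      _ ≤ A1Const μ v * (K * μ (Metric.ball z t)) * ENNReal.ofReal (v x) := by gcongr
      _ = _ := by ring
  calc ∫⁻ x in B, ballMaximal μ (B.indicator v) x ∂μ
      ≤ ∫⁻ x in B, K * A1Const μ v * ENNReal.ofReal (v x) ∂μ :=
        lintegral_mono_ae (ae_restrict_of_ae key)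
    _ = K * A1Const μ v * weightMeasure μ v B := by
        rw [lintegral_const_mul _ hv.measurable.ennreal_ofReal, weightMeasure_apply]

/-- `[w^s]_{A₁} ≤ ([w]_{A₁} [w]_{RH_s})^s`. -/
theorem A1Const_rpow_le {n : ℕ} {μ : Measure (Rn n)} [SFinite μ]
    (hμ : IsDoubling μ) {w : Rn n → ℝ} (hw : IsA1 μ w) {s : ℝ≥0∞} (hs : 1 ≤ s) (hs' : s ≠ ∞) :
    A1Const μ (fun x => w x ^ s.toReal) ≤ (A1Const μ w * RHConst μ s w) ^ s.toReal := by
  rcases eq_or_ne s 1 with rfl | hs1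
  · simp [RHConst]
  have hs0 : 0 < s.toReal := ENNReal.toReal_pos (one_pos.trans_le hs).ne' hs'
  refine iSup₂_le fun Q hQ => ?_
  have h1 : avg μ w 1 Q * avg μ (fun x => (w x)⁻¹) ∞ Q ≤ A1Const μ w :=
    le_iSup₂ (f := fun Q (_ : Q ∈ dyadicCubes n) => avg μ w 1 Q * avg μ (fun x => (w x)⁻¹) ∞ Q) Q hQ
  have h2 : avg μ w s Q * (avg μ w 1 Q)⁻¹ ≤ RHConst μ s w := by
    rw [RHConst, if_neg hs1]
    exact le_iSup₂ (f := fun Q (_ : Q ∈ dyadicCubes n) => avg μ w s Q * (avg μ w 1 Q)⁻¹) Q hQ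
  have h0 : avg μ w 1 Q ≠ 0 := by
    rw [hw.weight.avg_one]
    exact ENNReal.div_ne_zero.2
      ⟨hw.weight.weightMeasure_ne_zero (hμ.cube_ne_zero hQ), hμ.cube_ne_top hQ⟩
  have ht : avg μ w 1 Q ≠ ∞ := by
    rw [hw.weight.avg_one]
    exact ENNReal.div_ne_top (hw.weight.cube_ne_top hμ hw.const_lt_top.ne hQ) (hμ.cube_ne_zero hQ)
  rw [← div_eq_mul_inv, ENNReal.div_le_iff h0 ht] at h2
  have hinv : IsWeight fun x => (w x)⁻¹ :=
    ⟨hw.weight.measurable.inv, fun x => inv_pos.2 (hw.weight.pos x)⟩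
  have e : (fun x => (w x ^ s.toReal)⁻¹) = fun x => (w x)⁻¹ ^ s.toReal :=
    funext fun x => (Real.inv_rpow (hw.weight.pos x).le _).symm
  rw [e, hw.weight.avg_rpow hs0, hinv.avg_rpow hs0, one_mul, ENNReal.ofReal_toReal hs',
    ENNReal.top_mul (one_pos.trans_le hs).ne', ← ENNReal.mul_rpow_of_nonneg _ _ hs0.le]
  refine ENNReal.rpow_le_rpow ?_ hs0.le
  calc avg μ w s Q * avg μ (fun x => (w x)⁻¹) ∞ Q
      ≤ RHConst μ s w * avg μ w 1 Q * avg μ (fun x => (w x)⁻¹) ∞ Q := by gcongr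
    _ = avg μ w 1 Q * avg μ (fun x => (w x)⁻¹) ∞ Q * RHConst μ s w := by ring
    _ ≤ _ := by gcongr

/-! ### The dyadic maximal function -/

theorem lintegral_iSup_grid_rpow_le {n : ℕ} (ω : Measure (Rn n)) [SFinite ω] (a : Fin n → Fin 3)
    (h0 : ∀ Q ∈ dyadicGrid a, ω Q ≠ 0) (ht : ∀ Q ∈ dyadicGrid a, ω Q ≠ ∞)
    {t : ℝ} (h1t : 1 < t) {f : Rn n → ℝ≥0∞} (hf : Measurable f) :
    ∫⁻ x, (⨆ Q ∈ dyadicGrid a, Q.indicator (fun _ => (∫⁻ y in Q, f y ∂ω) / ω Q) x) ^ t ∂ω ≤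
      ENNReal.ofReal (2 ^ t * (t / (t - 1))) * ∫⁻ x, f x ^ t ∂ω := by
  classical
  have ht0 : 0 < t := by linarith
  obtain ⟨e, he⟩ := ((countable_dyadicCubes n).mono (dyadicGrid_subset a)).exists_eq_range
    ⟨_, 0, 0, rfl⟩
  have hmem : ∀ i, e i ∈ dyadicGrid a := fun i => he ▸ mem_range_self i
  have hme : ∀ i, MeasurableSet (e i) := fun i => measurableSet_of_mem_grid (hmem i)
  set A : Set (Rn n) → ℝ≥0∞ := fun Q => (∫⁻ y in Q, f y ∂ω) / ω Q with hA
  set g : ℕ → Rn n → ℝ≥0∞ := fun i => (e i).indicator fun _ => A (e i) with hg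
  have hgm : ∀ i, Measurable (g i) := fun i => measurable_const.indicator (hme i)
  set m : ℕ → Rn n → ℝ≥0∞ := fun N x => (Finset.range (N + 1)).sup fun i => g i x with hm
  have hmm : ∀ N, Measurable (m N) := fun N => by
    have : m N = fun x => ⨆ i ∈ Finset.range (N + 1), g i x :=
      funext fun x => Finset.sup_eq_iSup _ _
    rw [this]
    exact Measurable.iSup fun i => Measurable.iSup fun _ => hgm i
  have hmono : ∀ x, Monotone fun N => m N x := fun x N M hNM =>
    Finset.sup_mono (Finset.range_mono (by omega))
  have hsup : ∀ x, ⨆ Q ∈ dyadicGrid a, Q.indicator (fun _ => A Q) x = ⨆ N, m N x := by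
    intro x
    rw [he, iSup_range]
    refine le_antisymm (iSup_le fun i => ?_) (iSup_le fun N => Finset.sup_le fun i _ => ?_)
    · exact (Finset.le_sup (f := fun i => g i x) (Finset.self_mem_range_succ i)).trans
        (le_iSup (fun N => m N x) i)
    · exact le_iSup (fun i => (e i).indicator (fun _ => A (e i)) x) i
  have hpow : ∀ x, (⨆ N, m N x) ^ t = ⨆ N, m N x ^ t := fun x =>
    (ENNReal.orderIsoRpow t ht0).map_iSup _
  change ∫⁻ x, (⨆ Q ∈ dyadicGrid a, Q.indicator (fun _ => A Q) x) ^ t ∂ω ≤ _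
  simp_rw [hsup, hpow]
  rw [lintegral_iSup (fun N => (hmm N).pow_const t) fun N M hNM x =>
    ENNReal.rpow_le_rpow (hmono x hNM) ht0.le]
  refine iSup_le fun N => ?_
  set I := Finset.range (N + 1) with hI
  -- the set on which the cube with index `i` realizes the maximum
  set G : ℕ → Set (Rn n) := fun i => if i ∈ I then e i ∩ {x | m N x = g i x} else ∅ with hG
  have hGm : ∀ i, MeasurableSet (G i) := fun i => by
    simp only [hG]
    split_ifs
    · exact (hme i).inter (measurableSet_eq_fun (hmm N) (hgm i))
    · exact MeasurableSet.empty
  have hdm : ∀ i, MeasurableSet (disjointed G i) := fun i => MeasurableSet.disjointed hGm i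
  have hGe : ∀ i, disjointed G i ⊆ e i := fun i => (disjointed_subset G i).trans <| by
    simp only [hG]
    split_ifs
    · exact inter_subset_left
    · exact empty_subset _
  have hGg : ∀ i, ∀ x ∈ disjointed G i, m N x = A (e i) := fun i x hx => by
    have hx1 := disjointed_subset G i hx
    simp only [hG] at hx1
    split_ifs at hx1
    · rw [hx1.2]; exact indicator_of_mem hx1.1 _
    · exact absurd hx1 (notMem_empty x)
  have hcover : ∀ x, x ∉ ⋃ i ∈ I, disjointed G i → m N x = 0 := by
    intro x hx
    by_contra hne
    obtain ⟨i, hi, hsi⟩ := Finset.exists_mem_eq_sup I ⟨0, by simp [hI]⟩ fun i => g i x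
    have hxi : x ∈ e i := by
      by_contra hxi
      refine hne (hsi.trans ?_)
      exact indicator_of_notMem hxi _
    have hxG : x ∈ ⋃ j, disjointed G j := by
      rw [iUnion_disjointed]
      refine mem_iUnion.2 ⟨i, ?_⟩
      simp only [hG, if_pos hi]
      exact ⟨hxi, hsi⟩
    obtain ⟨j, hj⟩ := mem_iUnion.1 hxG
    refine hx (mem_iUnion₂.2 ⟨j, ?_, hj⟩)
    by_contra hjI
    have := disjointed_subset G j hj
    simp [hG, hjI] at this
  set c : Set (Rn n) → ℝ≥0∞ := fun Q => ∑ i ∈ I with e i = Q, ω (disjointed G i) with hc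
  have hdisj : ∀ s : Set ℕ, s.PairwiseDisjoint (disjointed G) := fun s i _ j _ hij =>
    disjoint_disjointed G hij
  have hS : ∀ Q ∈ I.image e, Q ∈ dyadicGrid a := fun Q hQ => by
    obtain ⟨i, -, rfl⟩ := Finset.mem_image.1 hQ
    exact hmem i
  have hce := carleson_embedding ω (I.image e) (fun Q hQ Q' hQ' => grid_laminar (hS Q hQ) (hS Q' hQ'))
    (fun Q hQ => measurableSet_of_mem_grid (hS Q hQ)) c (fun Q => ω Q) (fun Q hQ => h0 Q (hS Q hQ))
    (fun Q hQ => ht Q (hS Q hQ)) (fun Q _ => le_rfl) 1 (fun R hR => by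
      have e1 : ∑ Q ∈ I.image e with Q ⊆ R, c Q = ∑ i ∈ I with e i ⊆ R, ω (disjointed G i) := by
        rw [← Finset.sum_fiberwise_of_maps_to (s := I.filter fun i => e i ⊆ R)
          (t := (I.image e).filter fun Q => Q ⊆ R) (g := e)]
        · refine Finset.sum_congr rfl fun Q hQ => ?_
          rw [hc, Finset.filter_filter]
          refine Finset.sum_congr (Finset.filter_congr fun i _ => ?_) fun _ _ => rfl
          constructor
          · rintro rfl; exact ⟨(Finset.mem_filter.1 hQ).2, rfl⟩
          · exact fun h => h.2
        · intro i hi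
          rw [Finset.mem_filter] at hi ⊢
          exact ⟨Finset.mem_image_of_mem e hi.1, hi.2⟩
      rw [e1, one_mul, ← measure_biUnion_finset (hdisj _) fun i _ => hdm i]
      exact measure_mono (iUnion₂_subset fun i hi => (hGe i).trans (Finset.mem_filter.1 hi).2))
    h1t f hf.aemeasurable
  rw [one_mul] at hce
  refine le_trans ?_ hce
  calc ∫⁻ x, m N x ^ t ∂ω = ∫⁻ x in ⋃ i ∈ I, disjointed G i, m N x ^ t ∂ω := by
        refine (setLIntegral_eq_of_support_subset ?_).symm
        intro x hx
        by_contra hxn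
        exact hx (by simp [hcover x hxn, ht0])
    _ = ∑ i ∈ I, ω (disjointed G i) * A (e i) ^ t := by
        rw [lintegral_biUnion_finset (hdisj _) fun i _ => hdm i]
        refine Finset.sum_congr rfl fun i _ => ?_
        rw [setLIntegral_congr_fun (hdm i) fun x hx => by rw [hGg i x hx]]
        simp [mul_comm]
    _ = ∑ Q ∈ I.image e, c Q * A Q ^ t := by
        rw [← Finset.sum_fiberwise_of_maps_to (g := e) (t := I.image e)
          fun i hi => Finset.mem_image_of_mem e hi]
        refine Finset.sum_congr rfl fun Q _ => ?_
        rw [hc, Finset.sum_mul]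
        refine Finset.sum_congr rfl fun i hi => ?_
        rw [(Finset.mem_filter.1 hi).2]
    _ ≤ _ := le_rfl

/-! ### The dual weight of an `A₁` weight belongs to `A_∞` -/

theorem IsWeight.ofReal_rpow {n : ℕ} {w : Rn n → ℝ} (hw : IsWeight w) (s : ℝ) (x : Rn n) :
    ENNReal.ofReal (w x ^ s) = ENNReal.ofReal (w x) ^ s :=
  (ENNReal.ofReal_rpow_of_pos (hw.pos x)).symm

theorem IsWeight.ofReal_ne_zero {n : ℕ} {w : Rn n → ℝ} (hw : IsWeight w) (x : Rn n) :
    ENNReal.ofReal (w x) ≠ 0 := by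
  simp [hw.pos x]

theorem locallyIntegrable_of_cube {n : ℕ} {μ : Measure (Rn n)} [SFinite μ]
    {v : Rn n → ℝ} (hv : IsWeight v) (h : ∀ Q ∈ dyadicCubes n, weightMeasure μ v Q ≠ ∞) :
    LocallyIntegrable v μ := by
  intro x
  obtain ⟨a, k, m, hs, -⟩ := exists_dyadicCube_ball_subset x one_pos
  refine ⟨dyadicCube a k m, Filter.mem_of_superset (Metric.ball_mem_nhds x one_pos) hs,
    hv.measurable.aestronglyMeasurable, ?_⟩
  rw [hasFiniteIntegral_iff_enorm]
  simp only [hv.enorm_eq]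
  rw [← weightMeasure_apply]
  exact (h _ (dyadicGrid_subset a ⟨k, m, rfl⟩)).lt_top

theorem dual_cube_ne_top {n : ℕ} {μ : Measure (Rn n)} [SFinite μ]
    (hμ : IsDoubling μ) {w : Rn n → ℝ} (hw : IsA1 μ w) {r : ℝ} (hr : r ≤ 0) {Q : Set (Rn n)}
    (hQ : Q ∈ dyadicCubes n) : weightMeasure μ (fun x => w x ^ r) Q ≠ ∞ := by
  have hae := hw.weight.ae_weightMeasure_le hμ hQ
  have hWQ := hw.weight.weightMeasure_ne_zero (hμ.cube_ne_zero hQ)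
  set c := weightMeasure μ w Q / (A1Const μ w * μ Q) with hc
  have hden : A1Const μ w * μ Q ≠ ∞ := ENNReal.mul_ne_top hw.const_lt_top.ne (hμ.cube_ne_top hQ)
  have hc0 : c ≠ 0 := ENNReal.div_ne_zero.2 ⟨hWQ, hden⟩
  have hle : ∀ᵐ x ∂μ.restrict Q, ENNReal.ofReal (w x ^ r) ≤ c ^ r := by
    filter_upwards [hae] with x hx
    rw [hw.weight.ofReal_rpow]
    have h1 : c ≤ ENNReal.ofReal (w x) := ENNReal.div_le_of_le_mul (by rw [mul_comm]; exact hx)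
    rw [← neg_neg r, ENNReal.rpow_neg _ (-r), ENNReal.rpow_neg _ (-r)]
    exact ENNReal.inv_le_inv.2 (ENNReal.rpow_le_rpow h1 (neg_nonneg.2 hr))
  rw [weightMeasure_apply]
  refine ((lintegral_mono_ae hle).trans_lt ?_).ne
  rw [lintegral_const, Measure.restrict_apply_univ]
  refine ENNReal.mul_lt_top ?_ (hμ.cube_ne_top hQ).lt_top
  rw [← neg_neg r, ENNReal.rpow_neg]
  rw [ENNReal.inv_lt_top]
  exact pos_iff_ne_zero.2 fun h => by
    rcases ENNReal.rpow_eq_zero_iff.1 h with h | h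
    · exact hc0 h.1
    · linarith [h.2]

theorem ballMaximal_le_of_A1 {n : ℕ} {μ : Measure (Rn n)} [SFinite μ]
    (hμ : IsDoubling μ) {K : ℝ≥0∞} (hK : Comparison μ K) {w : Rn n → ℝ} (hw : IsA1 μ w)
    {u : Rn n → ℝ} (hu : IsWeight u) {B : Set (Rn n)} (hB : MeasurableSet B) {x : Rn n} :
    ballMaximal μ (B.indicator u) x ≤ K * A1Const μ w * ⨆ a : Fin n → Fin 3,
      ⨆ Q ∈ dyadicGrid a, Q.indicator (fun _ => (∫⁻ y in Q,
        B.indicator (fun y => ENNReal.ofReal (u y)) y ∂weightMeasure μ w) / weightMeasure μ w Q) x := by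
  refine iSup_le fun z => iSup_le fun t => iSup_le fun ht => iSup_le fun hxt => ?_
  rw [avg_ball_indicator_le hu hB]
  obtain ⟨R, hR, hBR, hRK⟩ := hK.exists_cube z t ht
  have hRm := measurableSet_of_mem_cubes hR
  set f : Rn n → ℝ≥0∞ := B.indicator fun y => ENNReal.ofReal (u y) with hf
  have hfm : Measurable f := hu.measurable.ennreal_ofReal.indicator hB
  set N := ⨆ a : Fin n → Fin 3, ⨆ Q ∈ dyadicGrid a, Q.indicator (fun _ => (∫⁻ y in Q,
        f y ∂weightMeasure μ w) / weightMeasure μ w Q) x with hN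
  have hN1 : (∫⁻ y in R, f y ∂weightMeasure μ w) / weightMeasure μ w R ≤ N := by
    obtain ⟨a, ha⟩ := mem_iUnion.1 hR
    refine le_trans ?_ (le_iSup (fun a : Fin n → Fin 3 => ⨆ Q ∈ dyadicGrid a,
      Q.indicator (fun _ => (∫⁻ y in Q, f y ∂weightMeasure μ w) / weightMeasure μ w Q) x) a)
    refine le_trans (le_of_eq ?_) (le_iSup₂ R ha)
    rw [indicator_of_mem (hBR hxt)]
  have h0 := hw.weight.weightMeasure_ne_zero (hμ.cube_ne_zero hR)
  have h1 := hw.weight.cube_ne_top hμ hw.const_lt_top.ne hR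
  rw [ENNReal.div_le_iff h0 h1] at hN1
  have hmain : weightMeasure μ w R * ∫⁻ y in R, f y ∂μ ≤
      A1Const μ w * μ R * ∫⁻ y in R, f y ∂weightMeasure μ w := by
    rw [setLIntegral_weightMeasure μ hw.weight f hRm, ← lintegral_const_mul _ hfm,
      ← lintegral_const_mul _ (f := fun x => ENNReal.ofReal (w x) * f x)
        (hw.weight.measurable.ennreal_ofReal.mul hfm)]
    refine lintegral_mono_ae ?_
    filter_upwards [hw.weight.ae_weightMeasure_le hμ hR] with y hy
    rw [← mul_assoc]
    gcongr
  have h2 : ∫⁻ y in R, f y ∂μ ≤ A1Const μ w * μ R * N := by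
    refine (ENNReal.mul_le_mul_iff_right h0 h1).1 (hmain.trans ?_)
    calc A1Const μ w * μ R * ∫⁻ y in R, f y ∂weightMeasure μ w
        ≤ A1Const μ w * μ R * (N * weightMeasure μ w R) := by gcongr
      _ = _ := by ring
  refine ENNReal.div_le_of_le_mul ?_
  calc weightMeasure μ u (B ∩ Metric.ball z t) ≤ weightMeasure μ u (B ∩ R) := by gcongr
    _ = ∫⁻ y in R, f y ∂μ := by
        rw [weightMeasure_apply, hf, lintegral_indicator hB, Measure.restrict_restrict hB]
    _ ≤ A1Const μ w * μ R * N := h2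
    _ ≤ A1Const μ w * (K * μ (Metric.ball z t)) * N := by gcongr
    _ = _ := by ring

theorem IsA1.dual_isAInfty {n : ℕ} {μ : Measure (Rn n)} [SFinite μ]
    (hμ : IsDoubling μ) {K : ℝ≥0∞} (hK : Comparison μ K) {w : Rn n → ℝ} (hw : IsA1 μ w)
    {P q : ℝ} (hPq : P.HolderConjugate q) : IsAInfty μ fun x => w x ^ (1 - q) := by
  have hP := hPq.pos
  have hq := hPq.symm.pos
  have hr : 1 - q ≤ 0 := by linarith [hPq.symm.lt]
  set σ : Rn n → ℝ := fun x => w x ^ (1 - q) with hσ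
  have hσw : IsWeight σ := hw.weight.rpow _
  have hσQ : ∀ Q ∈ dyadicCubes n, weightMeasure μ σ Q ≠ ∞ := fun Q hQ =>
    dual_cube_ne_top hμ hw hr hQ
  refine ⟨hσw, locallyIntegrable_of_cube hσw hσQ, ?_⟩
  have hW0 : ∀ {Q}, Q ∈ dyadicCubes n → weightMeasure μ w Q ≠ 0 := fun hQ =>
    hw.weight.weightMeasure_ne_zero (hμ.cube_ne_zero hQ)
  have hWt : ∀ {Q}, Q ∈ dyadicCubes n → weightMeasure μ w Q ≠ ∞ := fun hQ =>
    hw.weight.cube_ne_top hμ hw.const_lt_top.ne hQ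
  set C : ℝ≥0∞ := (Fintype.card (Fin n → Fin 3)) * ENNReal.ofReal (2 ^ P * (P / (P - 1))) with hC
  have hCt : C ≠ ∞ := by rw [hC]; finiteness
  refine lt_of_le_of_lt (b := K * A1Const μ w * C ^ (1 / P)) ?_ ?_
  swap
  · exact ENNReal.mul_lt_top (ENNReal.mul_lt_top hK.ne_top.lt_top hw.const_lt_top)
      (ENNReal.rpow_lt_top_of_nonneg (by positivity) hCt)
  refine iSup_le fun y => iSup_le fun r => iSup_le fun hr => ?_
  set B := Metric.ball y r with hB
  have hBm : MeasurableSet B := measurableSet_ball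
  refine ENNReal.div_le_of_le_mul ?_
  set f : Rn n → ℝ≥0∞ := B.indicator fun y => ENNReal.ofReal (σ y) with hf
  have hfm : Measurable f := hσw.measurable.ennreal_ofReal.indicator hBm
  set N : (Fin n → Fin 3) → Rn n → ℝ≥0∞ := fun a x => ⨆ Q ∈ dyadicGrid a, Q.indicator (fun _ =>
    (∫⁻ y in Q, f y ∂weightMeasure μ w) / weightMeasure μ w Q) x with hN
  have hNm : ∀ a, Measurable (N a) := fun a =>
    Measurable.biSup _ ((countable_dyadicCubes n).mono (dyadicGrid_subset a)) fun Q hQ =>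
      measurable_const.indicator (measurableSet_of_mem_grid hQ)
  set M : Rn n → ℝ≥0∞ := fun x => ⨆ a, N a x with hM
  have hMm : Measurable M := Measurable.iSup hNm
  have hfP : ∫⁻ x, f x ^ P ∂weightMeasure μ w = weightMeasure μ σ B := by
    rw [lintegral_weightMeasure μ hw.weight, weightMeasure_apply, ← lintegral_indicator hBm]
    refine lintegral_congr fun x => ?_
    by_cases hx : x ∈ B
    · simp only [hf, indicator_of_mem hx, hσ]
      rw [hw.weight.ofReal_rpow, ← ENNReal.rpow_mul]
      nth_rw 1 [← ENNReal.rpow_one (ENNReal.ofReal (w x))]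
      rw [← ENNReal.rpow_add _ _ (hw.weight.ofReal_ne_zero x) ENNReal.ofReal_ne_top]
      congr 1
      have := hPq.mul_eq_add
      linarith
    · simp [hf, hx, hP]
  have hMP : ∫⁻ x, M x ^ P ∂weightMeasure μ w ≤ C * weightMeasure μ σ B := by
    calc ∫⁻ x, M x ^ P ∂weightMeasure μ w ≤ ∫⁻ x, ∑ a, N a x ^ P ∂weightMeasure μ w := by
          refine lintegral_mono fun x => ?_
          rw [show M x ^ P = ⨆ a, N a x ^ P from (ENNReal.orderIsoRpow P hP).map_iSup _]
          exact iSup_le fun a => Finset.single_le_sum (f := fun a => N a x ^ P)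
            (fun _ _ => zero_le) (Finset.mem_univ a)
      _ = ∑ a, ∫⁻ x, N a x ^ P ∂weightMeasure μ w :=
          lintegral_finsetSum _ fun a _ => (hNm a).pow_const P
      _ ≤ ∑ _a : Fin n → Fin 3, ENNReal.ofReal (2 ^ P * (P / (P - 1))) *
            weightMeasure μ σ B := by
          refine Finset.sum_le_sum fun a _ => ?_
          rw [← hfP]
          exact lintegral_iSup_grid_rpow_le _ a (fun Q hQ => hW0 (dyadicGrid_subset a hQ))
            (fun Q hQ => hWt (dyadicGrid_subset a hQ)) hPq.lt hfm
      _ = _ := by rw [Finset.sum_const, Finset.card_univ, nsmul_eq_mul, hC, mul_assoc]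
  have hwm := hw.weight.measurable.ennreal_ofReal
  calc ∫⁻ x in B, ballMaximal μ (B.indicator σ) x ∂μ
      ≤ ∫⁻ x in B, K * A1Const μ w * M x ∂μ :=
        lintegral_mono fun x => ballMaximal_le_of_A1 hμ hK hw hσw hBm
    _ = K * A1Const μ w * ∫⁻ x in B, M x ∂μ := lintegral_const_mul _ hMm
    _ ≤ K * A1Const μ w * (C ^ (1 / P) * weightMeasure μ σ B) := by
        gcongr
        calc ∫⁻ x in B, M x ∂μ = ∫⁻ x in B, ((fun x => ENNReal.ofReal (w x) ^ (1 / P) * M x) *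
              fun x => ENNReal.ofReal (w x) ^ (-(1 / P))) x ∂μ := by
              refine lintegral_congr fun x => ?_
              simp only [Pi.mul_apply]
              rw [mul_right_comm, ← ENNReal.rpow_add _ _ (hw.weight.ofReal_ne_zero x)
                ENNReal.ofReal_ne_top]
              simp
          _ ≤ (∫⁻ x in B, (ENNReal.ofReal (w x) ^ (1 / P) * M x) ^ P ∂μ) ^ (1 / P) *
              (∫⁻ x in B, (ENNReal.ofReal (w x) ^ (-(1 / P))) ^ q ∂μ) ^ (1 / q) :=
              ENNReal.lintegral_mul_le_Lp_mul_Lq _ hPq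
                ((hwm.pow_const _).mul hMm).aemeasurable (hwm.pow_const _).aemeasurable
          _ ≤ (C * weightMeasure μ σ B) ^ (1 / P) * weightMeasure μ σ B ^ (1 / q) := by
              gcongr
              · refine le_trans ?_ hMP
                rw [lintegral_weightMeasure μ hw.weight]
                refine (setLIntegral_le_lintegral _ _).trans (lintegral_mono fun x => le_of_eq ?_)
                rw [ENNReal.mul_rpow_of_nonneg _ _ hP.le, ← ENNReal.rpow_mul,
                  one_div_mul_cancel hP.ne', ENNReal.rpow_one]
              · rw [weightMeasure_apply]
                refine lintegral_mono fun x => le_of_eq ?_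
                rw [← ENNReal.rpow_mul, hσ]
                simp only
                rw [hw.weight.ofReal_rpow]
                congr 1
                have h1 := hPq.inv_add_inv_eq_one
                have h2 : q * (P⁻¹ + q⁻¹) = q * 1 := by rw [h1]
                rw [mul_add, mul_inv_cancel₀ hq.ne'] at h2
                rw [one_div]; linarith
          _ = C ^ (1 / P) * weightMeasure μ σ B := by
              rw [ENNReal.mul_rpow_of_nonneg _ _ (by positivity), mul_assoc,
                ← ENNReal.rpow_add_of_nonneg _ _ (by positivity) (by positivity),
                one_div, one_div, hPq.inv_add_inv_eq_one, ENNReal.rpow_one]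
    _ = _ := by ring

/-! ### Bounds for sparse forms -/

/-- The constant of the Carleson embedding theorem. -/
noncomputable def embConst (t : ℝ) : ℝ≥0∞ := ENNReal.ofReal (2 ^ t * (t / (t - 1)))

open Classical in
theorem sum_subset_measure_le {α : Type*} [MeasurableSpace α] (μ : Measure α)
    {F : Finset (Set α)} {E : Set α → Set α} {e : ℝ≥0∞}
    (hE : ∀ Q ∈ F, MeasurableSet (E Q) ∧ E Q ⊆ Q ∧ μ Q ≤ e * μ (E Q))
    (hd : (F : Set (Set α)).PairwiseDisjoint E) (R : Set α) :
    ∑ Q ∈ F with Q ⊆ R, μ Q ≤ e * μ R := by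
  calc ∑ Q ∈ F with Q ⊆ R, μ Q ≤ ∑ Q ∈ F with Q ⊆ R, e * μ (E Q) :=
        Finset.sum_le_sum fun Q hQ => (hE Q (Finset.mem_filter.1 hQ).1).2.2
    _ = e * μ (⋃ Q ∈ F.filter fun Q => Q ⊆ R, E Q) := by
        rw [← Finset.mul_sum, measure_biUnion_finset
          (hd.subset fun Q hQ => (Finset.mem_filter.1 hQ).1)
          fun Q hQ => (hE Q (Finset.mem_filter.1 hQ).1).1]
    _ ≤ e * μ R := by
        gcongr
        refine iUnion₂_subset fun Q hQ => ?_
        have := Finset.mem_filter.1 hQ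
        exact (hE Q this.1).2.1.trans this.2

section Sparse

variable {n : ℕ} {μ : Measure (Rn n)} [SFinite μ] {K : ℝ≥0∞} {a : Fin n → Fin 3}
  {U : Set (Rn n) → Set (Rn n)} {F : Finset (Set (Rn n))} {E : Set (Rn n) → Set (Rn n)} {e : ℝ≥0∞}

open Classical in
theorem sum_subset_weight_le (hμ : IsDoubling μ)
    (hU : ∀ Q ∈ dyadicGrid a,
      (∃ (y : Rn n) (r : ℝ), 0 < r ∧ U Q = Metric.ball y r) ∧ Q ⊆ U Q ∧ μ (U Q) ≤ K * μ Q ∧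
      ∀ Q' ∈ dyadicGrid a, Q' ⊆ Q → U Q' ⊆ U Q)
    (hF : ∀ Q ∈ F, Q ∈ dyadicGrid a)
    (hE : ∀ Q ∈ F, MeasurableSet (E Q) ∧ E Q ⊆ Q ∧ μ Q ≤ e * μ (E Q))
    (hd : (F : Set (Set (Rn n))).PairwiseDisjoint E) {v : Rn n → ℝ} (hv : IsWeight v)
    (hA : A1Const μ v ≠ ∞) {R : Set (Rn n)} (hR : R ∈ F) :
    ∑ Q ∈ F with Q ⊆ R, weightMeasure μ v (U Q) ≤
      K * e * AInftyConst μ v * weightMeasure μ v (U R) := by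
  obtain ⟨⟨y, r, hr, hball⟩, -, -, hUR⟩ := hU R (hF R hR)
  have hterm : ∀ Q ∈ F.filter fun Q => Q ⊆ R, weightMeasure μ v (U Q) ≤
      K * e * ∫⁻ x in E Q, ballMaximal μ ((U R).indicator v) x ∂μ := by
    intro Q hQ
    obtain ⟨hQF, hQR⟩ := Finset.mem_filter.1 hQ
    obtain ⟨⟨z, t, ht, hb⟩, hQU, hK, -⟩ := hU Q (hF Q hQF)
    obtain ⟨hEm, hEQ, hEμ⟩ := hE Q hQF
    have hU0 : μ (U Q) ≠ 0 := by rw [hb]; exact (hμ.ball_pos z t ht).ne'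
    have hUt : μ (U Q) ≠ ∞ := by rw [hb]; exact (hμ.ball_lt_top z t ht).ne
    have hpt : ∀ x ∈ E Q, weightMeasure μ v (U Q) / μ (U Q) ≤
        ballMaximal μ ((U R).indicator v) x := by
      intro x hx
      have : weightMeasure μ v (U Q) / μ (U Q) = avg μ ((U R).indicator v) 1 (Metric.ball z t) := by
        rw [avg_ball_indicator_le hv (hball ▸ measurableSet_ball), ← hb,
          inter_eq_right.2 (hUR Q (hF Q hQF) hQR)]
      rw [this]
      refine le_trans ?_ (le_iSup₂ (f := fun (z : Rn n) (t : ℝ) => ⨆ (_ : 0 < t)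
        (_ : x ∈ Metric.ball z t), avg μ ((U R).indicator v) 1 (Metric.ball z t)) z t)
      exact le_iSup₂ (f := fun (_ : 0 < t) (_ : x ∈ Metric.ball z t) =>
        avg μ ((U R).indicator v) 1 (Metric.ball z t)) ht (hb ▸ hQU (hEQ hx))
    calc weightMeasure μ v (U Q) = weightMeasure μ v (U Q) / μ (U Q) * μ (U Q) :=
          (ENNReal.div_mul_cancel hU0 hUt).symm
      _ ≤ weightMeasure μ v (U Q) / μ (U Q) * (K * (e * μ (E Q))) := by
          gcongr; exact hK.trans (by gcongr)
      _ = K * e * ∫⁻ x in E Q, weightMeasure μ v (U Q) / μ (U Q) ∂μ := by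
          rw [setLIntegral_const]; ring
      _ ≤ _ := by gcongr 1; exact setLIntegral_mono' hEm hpt
  have h0 : weightMeasure μ v (U R) ≠ 0 :=
    hv.weightMeasure_ne_zero (by rw [hball]; exact (hμ.ball_pos y r hr).ne')
  have ht : weightMeasure μ v (U R) ≠ ∞ := by rw [hball]; exact hv.ball_ne_top hμ hA y r
  have hAI : ∫⁻ x in U R, ballMaximal μ ((U R).indicator v) x ∂μ ≤
      AInftyConst μ v * weightMeasure μ v (U R) := by
    rw [← ENNReal.div_le_iff h0 ht, hball]
    refine le_trans ?_ (le_iSup₂ (f := fun (y : Rn n) (r : ℝ) => ⨆ (_ : 0 < r),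
      (∫⁻ x in Metric.ball y r, ballMaximal μ ((Metric.ball y r).indicator v) x ∂μ) /
      weightMeasure μ v (Metric.ball y r)) y r)
    exact le_iSup (fun (_ : 0 < r) =>
      (∫⁻ x in Metric.ball y r, ballMaximal μ ((Metric.ball y r).indicator v) x ∂μ) /
      weightMeasure μ v (Metric.ball y r)) hr
  calc ∑ Q ∈ F with Q ⊆ R, weightMeasure μ v (U Q)
      ≤ ∑ Q ∈ F with Q ⊆ R, K * e * ∫⁻ x in E Q, ballMaximal μ ((U R).indicator v) x ∂μ :=
        Finset.sum_le_sum hterm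
    _ = K * e * ∫⁻ x in ⋃ Q ∈ F.filter fun Q => Q ⊆ R, E Q,
          ballMaximal μ ((U R).indicator v) x ∂μ := by
        rw [← Finset.mul_sum, lintegral_biUnion_finset
          (hd.subset fun Q hQ => (Finset.mem_filter.1 hQ).1)
          fun Q hQ => (hE Q (Finset.mem_filter.1 hQ).1).1]
    _ ≤ K * e * ∫⁻ x in U R, ballMaximal μ ((U R).indicator v) x ∂μ := by
        gcongr 1
        refine lintegral_mono_set (iUnion₂_subset fun Q hQ => ?_)
        obtain ⟨hQF, hQR⟩ := Finset.mem_filter.1 hQ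
        exact ((hE Q hQF).2.1.trans hQR).trans (hU R (hF R hR)).2.1
    _ ≤ K * e * (AInftyConst μ v * weightMeasure μ v (U R)) := by gcongr
    _ = _ := by ring

theorem sum_first_factor_le (hμ : IsDoubling μ) (hK : Comparison μ K)
    (hU : ∀ Q ∈ dyadicGrid a,
      (∃ (y : Rn n) (r : ℝ), 0 < r ∧ U Q = Metric.ball y r) ∧ Q ⊆ U Q ∧ μ (U Q) ≤ K * μ Q ∧
      ∀ Q' ∈ dyadicGrid a, Q' ⊆ Q → U Q' ⊆ U Q)
    (hF : ∀ Q ∈ F, Q ∈ dyadicGrid a)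
    (hE : ∀ Q ∈ F, MeasurableSet (E Q) ∧ E Q ⊆ Q ∧ μ Q ≤ e * μ (E Q))
    (hd : (F : Set (Set (Rn n))).PairwiseDisjoint E) {w : Rn n → ℝ} (hw : IsWeight w) {s : ℝ}
    (hs : 0 < s) {P₀ P : ℝ} (hP₀ : 0 < P₀) (hP : P₀ < P)
    {f : Rn n → ℝ≥0∞} (hf : AEMeasurable f μ) :
    ∑ Q ∈ F, ((∫⁻ x in Q, f x ^ P₀ ∂μ) / μ Q) ^ (P / P₀) *
        (weightMeasure μ (fun x => w x ^ s) (U Q) / μ Q) ^ (1 / s) * μ Q ≤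
      (K * K * A1Const μ fun x => w x ^ s) ^ (1 / s) *
        (e * (embConst (P / P₀) * ∫⁻ x, f x ^ P ∂weightMeasure μ w)) := by
  set v : Rn n → ℝ := fun x => w x ^ s with hv
  have hvw : IsWeight v := hw.rpow s
  set t := P / P₀ with ht
  have ht1 : 1 < t := (one_lt_div hP₀).2 hP
  have ht0 : 0 < t := by linarith
  set D := (K * K * A1Const μ v) ^ (1 / s) with hD
  set h : Rn n → ℝ≥0∞ := fun x => f x ^ P₀ * ENNReal.ofReal (w x) ^ (1 / t) with hh
  have hhm : AEMeasurable h μ :=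
    (hf.pow_const _).mul (hw.measurable.ennreal_ofReal.pow_const _).aemeasurable
  have hFm : ∀ Q ∈ F, MeasurableSet Q := fun Q hQ => measurableSet_of_mem_grid (hF Q hQ)
  have h0 : ∀ Q ∈ F, μ Q ≠ 0 := fun Q hQ => hμ.cube_ne_zero (dyadicGrid_subset a (hF Q hQ))
  have htop : ∀ Q ∈ F, μ Q ≠ ∞ := fun Q hQ => hμ.cube_ne_top (dyadicGrid_subset a (hF Q hQ))
  have hterm : ∀ Q ∈ F, ((∫⁻ x in Q, f x ^ P₀ ∂μ) / μ Q) ^ t *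
      (weightMeasure μ v (U Q) / μ Q) ^ (1 / s) * μ Q ≤
      D * (μ Q * ((∫⁻ x in Q, h x ∂μ) / μ Q) ^ t) := by
    intro Q hQ
    obtain ⟨⟨y, r, hr, hball⟩, hQU, hUK, -⟩ := hU Q (hF Q hQ)
    obtain ⟨R, hR, hBR, hRK⟩ := hK.exists_cube y r hr
    set β := (weightMeasure μ v (U Q) / μ Q) ^ (1 / s) with hβ
    have hae : ∀ᵐ x ∂μ.restrict Q, β ≤ D * ENNReal.ofReal (w x) := by
      have hQR : Q ⊆ R := (hQU.trans_eq hball).trans hBR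
      filter_upwards [ae_restrict_of_ae_restrict_of_subset hQR (hvw.ae_weightMeasure_le hμ hR)]
        with x hx
      have h1 : weightMeasure μ v (U Q) / μ Q ≤
          K * K * A1Const μ v * ENNReal.ofReal (w x) ^ s := by
        refine ENNReal.div_le_of_le_mul ?_
        calc weightMeasure μ v (U Q) ≤ weightMeasure μ v R := by rw [hball]; exact measure_mono hBR
          _ ≤ A1Const μ v * μ R * ENNReal.ofReal (v x) := hx
          _ ≤ A1Const μ v * (K * (K * μ Q)) * ENNReal.ofReal (w x) ^ s := by
              rw [hv, hw.ofReal_rpow]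
              gcongr
              exact hRK.trans (by rw [← hball]; gcongr)
          _ = _ := by ring
      calc β ≤ (K * K * A1Const μ v * ENNReal.ofReal (w x) ^ s) ^ (1 / s) :=
            ENNReal.rpow_le_rpow h1 (by positivity)
        _ = _ := by
            rw [ENNReal.mul_rpow_of_nonneg _ _ (by positivity), ← ENNReal.rpow_mul,
              mul_one_div_cancel hs.ne', ENNReal.rpow_one]
    have hint : β ^ (1 / t) * ∫⁻ x in Q, f x ^ P₀ ∂μ ≤ D ^ (1 / t) * ∫⁻ x in Q, h x ∂μ := by
      rw [← lintegral_const_mul'' _ (hf.pow_const P₀).restrict,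
        ← lintegral_const_mul'' _ hhm.restrict]
      refine lintegral_mono_ae ?_
      filter_upwards [hae] with x hx
      calc β ^ (1 / t) * f x ^ P₀ ≤ (D * ENNReal.ofReal (w x)) ^ (1 / t) * f x ^ P₀ := by
            gcongr
        _ = D ^ (1 / t) * h x := by
            rw [ENNReal.mul_rpow_of_nonneg _ _ (by positivity), hh]; ring
    have hpow : ∀ X : ℝ≥0∞, (X ^ (1 / t)) ^ t = X := fun X => by
      rw [← ENNReal.rpow_mul, one_div_mul_cancel ht0.ne', ENNReal.rpow_one]
    calc ((∫⁻ x in Q, f x ^ P₀ ∂μ) / μ Q) ^ t * β * μ Q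
        = (β ^ (1 / t) * (∫⁻ x in Q, f x ^ P₀ ∂μ) / μ Q) ^ t * μ Q := by
          rw [mul_div_assoc, ENNReal.mul_rpow_of_nonneg _ _ ht0.le, hpow]; ring
      _ ≤ (D ^ (1 / t) * (∫⁻ x in Q, h x ∂μ) / μ Q) ^ t * μ Q := by gcongr
      _ = _ := by
          rw [mul_div_assoc, ENNReal.mul_rpow_of_nonneg _ _ ht0.le, hpow]; ring
  refine (Finset.sum_le_sum hterm).trans ?_
  rw [← Finset.mul_sum]
  gcongr
  have hht : ∫⁻ x, h x ^ t ∂μ = ∫⁻ x, f x ^ P ∂weightMeasure μ w := by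
    rw [lintegral_weightMeasure μ hw]
    refine lintegral_congr fun x => ?_
    rw [hh]
    simp only
    rw [ENNReal.mul_rpow_of_nonneg _ _ ht0.le, ← ENNReal.rpow_mul, ← ENNReal.rpow_mul,
      one_div_mul_cancel ht0.ne', ENNReal.rpow_one, ht, mul_div_cancel₀ _ hP₀.ne', mul_comm]
  rw [← hht]
  exact carleson_embedding μ F (fun Q hQ Q' hQ' => grid_laminar (hF Q hQ) (hF Q' hQ')) hFm
    (fun Q => μ Q) (fun Q => μ Q) h0 htop (fun _ _ => le_rfl) e
    (fun R _ => sum_subset_measure_le μ hE hd R) ht1 h hhm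

theorem sum_second_factor_le (hμ : IsDoubling μ)
    (hU : ∀ Q ∈ dyadicGrid a,
      (∃ (y : Rn n) (r : ℝ), 0 < r ∧ U Q = Metric.ball y r) ∧ Q ⊆ U Q ∧ μ (U Q) ≤ K * μ Q ∧
      ∀ Q' ∈ dyadicGrid a, Q' ⊆ Q → U Q' ⊆ U Q)
    (hF : ∀ Q ∈ F, Q ∈ dyadicGrid a)
    (hE : ∀ Q ∈ F, MeasurableSet (E Q) ∧ E Q ⊆ Q ∧ μ Q ≤ e * μ (E Q))
    (hd : (F : Set (Set (Rn n))).PairwiseDisjoint E) {w : Rn n → ℝ} (hw : IsWeight w) {s : ℝ}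
    (hA : A1Const μ (fun x => w x ^ s) ≠ ∞) {b q : ℝ} (hb : 0 < b) (hq : b < q)
    (hsq : s * (1 - q / b) = 1 - q) {g : Rn n → ℝ≥0∞} (hg : AEMeasurable g μ) :
    ∑ Q ∈ F, weightMeasure μ (fun x => w x ^ s) (U Q) *
        ((∫⁻ x in Q, g x ^ b ∂μ) / weightMeasure μ (fun x => w x ^ s) (U Q)) ^ (q / b) ≤
      K * e * AInftyConst μ (fun x => w x ^ s) *
        (embConst (q / b) * ∫⁻ x, g x ^ q ∂weightMeasure μ fun x => w x ^ (1 - q)) := by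
  set v : Rn n → ℝ := fun x => w x ^ s with hv
  have hvw : IsWeight v := hw.rpow s
  set t := q / b with ht
  have ht1 : 1 < t := (one_lt_div hb).2 hq
  have ht0 : 0 < t := by linarith
  set h : Rn n → ℝ≥0∞ := fun x => g x ^ b * (ENNReal.ofReal (v x))⁻¹ with hh
  have hvm := hvw.measurable.ennreal_ofReal
  have hhm : AEMeasurable h μ := (hg.pow_const _).mul hvm.inv.aemeasurable
  have hFm : ∀ Q ∈ F, MeasurableSet Q := fun Q hQ => measurableSet_of_mem_grid (hF Q hQ)
  have hball : ∀ Q ∈ F, weightMeasure μ v (U Q) ≠ 0 ∧ weightMeasure μ v (U Q) ≠ ∞ := by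
    intro Q hQ
    obtain ⟨⟨y, r, hr, hball⟩, -⟩ := hU Q (hF Q hQ)
    rw [hball]
    exact ⟨hvw.weightMeasure_ne_zero (hμ.ball_pos y r hr).ne', hvw.ball_ne_top hμ hA y r⟩
  have hmulh : ∀ x, ENNReal.ofReal (v x) * h x = g x ^ b := fun x => by
    rw [hh]
    simp only
    rw [mul_left_comm, ENNReal.mul_inv_cancel (hvw.ofReal_ne_zero x) ENNReal.ofReal_ne_top, mul_one]
  have hint : ∀ Q ∈ F, ∫⁻ x in Q, h x ∂weightMeasure μ v = ∫⁻ x in Q, g x ^ b ∂μ := fun Q hQ => by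
    rw [setLIntegral_weightMeasure μ hvw h (hFm Q hQ)]
    simp_rw [hmulh]
  have hht : ∫⁻ x, h x ^ t ∂weightMeasure μ v =
      ∫⁻ x, g x ^ q ∂weightMeasure μ fun x => w x ^ (1 - q) := by
    rw [lintegral_weightMeasure μ hvw, lintegral_weightMeasure μ (hw.rpow _)]
    refine lintegral_congr fun x => ?_
    rw [hh, hv]
    simp only
    rw [ENNReal.mul_rpow_of_nonneg _ _ ht0.le, ← ENNReal.rpow_mul, ht, mul_div_cancel₀ _ hb.ne',
      mul_left_comm, mul_comm, ← ht, hw.ofReal_rpow, hw.ofReal_rpow, ← ENNReal.rpow_neg,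
      ← ENNReal.rpow_mul, ← ENNReal.rpow_add _ _ (hw.ofReal_ne_zero x) ENNReal.ofReal_ne_top]
    congr 2
    rw [← hsq]; ring
  have hce := carleson_embedding (weightMeasure μ v) F
    (fun Q hQ Q' hQ' => grid_laminar (hF Q hQ) (hF Q' hQ')) hFm
    (fun Q => weightMeasure μ v (U Q)) (fun Q => weightMeasure μ v (U Q))
    (fun Q hQ => (hball Q hQ).1) (fun Q hQ => (hball Q hQ).2)
    (fun Q hQ => measure_mono (hU Q (hF Q hQ)).2.1) (K * e * AInftyConst μ v)
    (fun R hR => sum_subset_weight_le hμ hU hF hE hd hvw hA hR) ht1 h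
    (hhm.mono_ac (withDensity_absolutelyContinuous _ _))
  rw [hht] at hce
  refine le_trans (Finset.sum_le_sum fun Q hQ => ?_) hce
  rw [hint Q hQ]

theorem sum_grid_le (hμ : IsDoubling μ) (hK : Comparison μ K)
    (hF : ∀ Q ∈ F, Q ∈ dyadicGrid a)
    (hE : ∀ Q ∈ F, MeasurableSet (E Q) ∧ E Q ⊆ Q ∧ μ Q ≤ e * μ (E Q))
    (hd : (F : Set (Set (Rn n))).PairwiseDisjoint E) {w : Rn n → ℝ} (hw : IsWeight w) {s : ℝ}
    (hs : 0 < s) (hA : A1Const μ (fun x => w x ^ s) ≠ ∞) {P₀ P b q : ℝ} (hP₀ : 0 < P₀)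
    (hP : P₀ < P) (hb : 0 < b) (hq : b < q) (hPq : P.HolderConjugate q)
    (hsP : 1 / (s * P) = 1 / b - 1 / q)
    {f g : Rn n → ℝ≥0∞} (hf : AEMeasurable f μ) (hg : AEMeasurable g μ) :
    ∑ Q ∈ F, ((∫⁻ x in Q, f x ^ P₀ ∂μ) / μ Q) ^ (1 / P₀) *
        ((∫⁻ x in Q, g x ^ b ∂μ) / μ Q) ^ (1 / b) * μ Q ≤
      ((K * K * A1Const μ fun x => w x ^ s) ^ (1 / s) *
        (e * (embConst (P / P₀) * ∫⁻ x, f x ^ P ∂weightMeasure μ w))) ^ (1 / P) *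
      (K * e * AInftyConst μ (fun x => w x ^ s) * (embConst (q / b) *
        ∫⁻ x, g x ^ q ∂weightMeasure μ fun x => w x ^ (1 - q))) ^ (1 / q) := by
  obtain ⟨U, hU⟩ := hK.exists_ball a
  have hPpos := hPq.pos
  have hqpos := hPq.symm.pos
  have hPq1 : 1 / P + 1 / q = 1 := by rw [one_div, one_div]; exact hPq.inv_add_inv_eq_one
  have hsq : s * (1 - q / b) = 1 - q := by
    have h1 : q / P = q - 1 := by
      have : q * (1 / P + 1 / q) = q * 1 := by rw [hPq1]
      rw [mul_add, mul_one_div_cancel hqpos.ne'] at this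
      rw [div_eq_mul_one_div]; linarith
    have h2 : s * q * (1 / (s * P)) = s * q * (1 / b - 1 / q) := by rw [hsP]
    have h3 : s * q * (1 / (s * P)) = q / P := by field_simp
    have h4 : s * q * (1 / b - 1 / q) = s * (q / b - 1) := by field_simp
    rw [h3, h4, h1] at h2
    linarith
  set v : Rn n → ℝ := fun x => w x ^ s with hv
  have hvw : IsWeight v := hw.rpow s
  refine le_trans ?_ (mul_le_mul'
    (ENNReal.rpow_le_rpow (sum_first_factor_le hμ hK hU hF hE hd hw hs hP₀ hP hf)
      (by positivity : 0 ≤ 1 / P))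
    (ENNReal.rpow_le_rpow (sum_second_factor_le hμ hU hF hE hd hw hA hb hq hsq hg)
      (by positivity : 0 ≤ 1 / q)))
  have hfac : ∀ Q ∈ F, ((∫⁻ x in Q, f x ^ P₀ ∂μ) / μ Q) ^ (1 / P₀) *
      ((∫⁻ x in Q, g x ^ b ∂μ) / μ Q) ^ (1 / b) * μ Q =
      (((∫⁻ x in Q, f x ^ P₀ ∂μ) / μ Q) ^ (P / P₀) *
        (weightMeasure μ v (U Q) / μ Q) ^ (1 / s) * μ Q) ^ (1 / P) *
      (weightMeasure μ v (U Q) *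
        ((∫⁻ x in Q, g x ^ b ∂μ) / weightMeasure μ v (U Q)) ^ (q / b)) ^ (1 / q) := by
    intro Q hQ
    obtain ⟨⟨y, r, hr, hball⟩, -⟩ := hU Q (hF Q hQ)
    have hV0 : weightMeasure μ v (U Q) ≠ 0 := by
      rw [hball]; exact hvw.weightMeasure_ne_zero (hμ.ball_pos y r hr).ne'
    have hVt : weightMeasure μ v (U Q) ≠ ∞ := by rw [hball]; exact hvw.ball_ne_top hμ hA y r
    have hm0 := hμ.cube_ne_zero (dyadicGrid_subset a (hF Q hQ))
    have hmt := hμ.cube_ne_top (dyadicGrid_subset a (hF Q hQ))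
    set V := weightMeasure μ v (U Q)
    set m := μ Q
    set X := (∫⁻ x in Q, f x ^ P₀ ∂μ) / m
    set Y := ∫⁻ x in Q, g x ^ b ∂μ
    rw [ENNReal.mul_rpow_of_nonneg _ _ (by positivity), ENNReal.mul_rpow_of_nonneg _ _ (by positivity),
      ENNReal.mul_rpow_of_nonneg _ _ (by positivity), ← ENNReal.rpow_mul, ← ENNReal.rpow_mul,
      ← ENNReal.rpow_mul, show P / P₀ * (1 / P) = 1 / P₀ by field_simp,
      show q / b * (1 / q) = 1 / b by field_simp, show 1 / s * (1 / P) = 1 / (s * P) by field_simp]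
    have hVm : (V / m) ^ (1 / (s * P)) * m ^ (1 / P) * (V ^ (1 / q) * (Y / V) ^ (1 / b)) =
        (Y / m) ^ (1 / b) * m := by
      have hdiv : ∀ (A B : ℝ≥0∞) {r : ℝ}, 0 ≤ r → (A / B) ^ r = A ^ r * B ^ (-r) :=
        fun A B r hr => by rw [ENNReal.div_rpow_of_nonneg _ _ hr, ENNReal.rpow_neg, div_eq_mul_inv]
      rw [hdiv V m (by positivity), hdiv Y V (by positivity), hdiv Y m (by positivity)]
      calc V ^ (1 / (s * P)) * m ^ (-(1 / (s * P))) * m ^ (1 / P) *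
            (V ^ (1 / q) * (Y ^ (1 / b) * V ^ (-(1 / b))))
          = Y ^ (1 / b) * (V ^ (1 / (s * P)) * V ^ (1 / q) * V ^ (-(1 / b))) *
            (m ^ (-(1 / (s * P))) * m ^ (1 / P)) := by ring
        _ = Y ^ (1 / b) * V ^ (0 : ℝ) * m ^ (-(1 / b) + 1) := by
            rw [← ENNReal.rpow_add _ _ hV0 hVt, ← ENNReal.rpow_add _ _ hV0 hVt,
              ← ENNReal.rpow_add _ _ hm0 hmt]
            rw [show 1 / (s * P) + 1 / q + -(1 / b) = 0 by linarith,
              show -(1 / (s * P)) + 1 / P = -(1 / b) + 1 by linarith]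
        _ = _ := by
            rw [ENNReal.rpow_zero, mul_one, ENNReal.rpow_add _ _ hm0 hmt, ENNReal.rpow_one]; ring
    calc X ^ (1 / P₀) * (Y / m) ^ (1 / b) * m = X ^ (1 / P₀) * ((Y / m) ^ (1 / b) * m) := by ring
      _ = _ := by rw [← hVm]; ring
  rw [Finset.sum_congr rfl hfac]
  refine (ENNReal.inner_le_Lp_mul_Lq F _ _ hPq).trans (le_of_eq ?_)
  have hpow : ∀ {r : ℝ} (X : ℝ≥0∞), 0 < r → (X ^ (1 / r)) ^ r = X := fun X hr => by
    rw [← ENNReal.rpow_mul, one_div_mul_cancel hr.ne', ENNReal.rpow_one]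
  simp only [hpow _ hPpos, hpow _ hqpos]
  rfl

/-- The bound for the full sparse form. -/
theorem tsum_sparse_le (hμ : IsDoubling μ) (hK : Comparison μ K) {η : ℝ}
    {S : Set (Set (Rn n))} (hS : IsSparse μ η S) {w : Rn n → ℝ} (hw : IsWeight w) {s : ℝ}
    (hs : 0 < s) (hA : A1Const μ (fun x => w x ^ s) ≠ ∞) {P₀ P b q : ℝ} (hP₀ : 0 < P₀)
    (hP : P₀ < P) (hb : 0 < b) (hq : b < q) (hPq : P.HolderConjugate q)
    (hsP : 1 / (s * P) = 1 / b - 1 / q)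
    {f g : Rn n → ℝ≥0∞} (hf : AEMeasurable f μ) (hg : AEMeasurable g μ) :
    ∑' Q : S, ((∫⁻ x in (Q : Set (Rn n)), f x ^ P₀ ∂μ) / μ (Q : Set (Rn n))) ^ (1 / P₀) *
        ((∫⁻ x in (Q : Set (Rn n)), g x ^ b ∂μ) / μ (Q : Set (Rn n))) ^ (1 / b) *
          μ (Q : Set (Rn n)) ≤
      3 ^ n * (((K * K * A1Const μ fun x => w x ^ s) ^ (1 / s) *
        (ENNReal.ofReal η⁻¹ * (embConst (P / P₀) * ∫⁻ x, f x ^ P ∂weightMeasure μ w))) ^ (1 / P) *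
      (K * ENNReal.ofReal η⁻¹ * AInftyConst μ (fun x => w x ^ s) * (embConst (q / b) *
        ∫⁻ x, g x ^ q ∂weightMeasure μ fun x => w x ^ (1 - q))) ^ (1 / q)) := by
  classical
  set φ : Set (Rn n) → ℝ≥0∞ := fun Q => ((∫⁻ x in Q, f x ^ P₀ ∂μ) / μ Q) ^ (1 / P₀) *
        ((∫⁻ x in Q, g x ^ b ∂μ) / μ Q) ^ (1 / b) * μ Q with hφ
  set Z := ((K * K * A1Const μ fun x => w x ^ s) ^ (1 / s) *
        (ENNReal.ofReal η⁻¹ * (embConst (P / P₀) * ∫⁻ x, f x ^ P ∂weightMeasure μ w))) ^ (1 / P) *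
      (K * ENNReal.ofReal η⁻¹ * AInftyConst μ (fun x => w x ^ s) * (embConst (q / b) *
        ∫⁻ x, g x ^ q ∂weightMeasure μ fun x => w x ^ (1 - q))) ^ (1 / q) with hZ
  change ∑' Q : S, φ Q ≤ 3 ^ n * Z
  have hsub : S ⊆ ⋃ a : Fin n → Fin 3, S ∩ dyadicGrid a := by
    rw [← inter_iUnion]; exact subset_inter subset_rfl hS.1
  have hgrid : ∀ a : Fin n → Fin 3, ∑' Q : (S ∩ dyadicGrid a : Set (Set (Rn n))), φ Q ≤ Z := by
    intro a
    obtain ⟨E, hE, hd⟩ := hS.2 a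
    rw [ENNReal.tsum_eq_iSup_sum]
    refine iSup_le fun G => ?_
    have e1 : ∑ Q ∈ G, φ Q = ∑ Q ∈ G.map (Function.Embedding.subtype _), φ Q := by
      rw [Finset.sum_map]; rfl
    have hG : ∀ Q ∈ G.map (Function.Embedding.subtype _), Q ∈ S ∩ dyadicGrid a := by
      intro Q hQ
      obtain ⟨Q', -, rfl⟩ := Finset.mem_map.1 hQ
      exact Q'.2
    rw [e1]
    exact sum_grid_le hμ hK (fun Q hQ => (hG Q hQ).2) (fun Q hQ => hE Q (hG Q hQ))
      (hd.subset fun Q hQ => hG Q hQ) hw hs hA hP₀ hP hb hq hPq hsP hf hg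
  calc ∑' Q : S, φ Q ≤ ∑' Q : (⋃ a : Fin n → Fin 3, S ∩ dyadicGrid a : Set (Set (Rn n))), φ Q :=
        ENNReal.tsum_mono_subtype φ hsub
    _ ≤ ∑ a : Fin n → Fin 3, ∑' Q : (S ∩ dyadicGrid a : Set (Set (Rn n))), φ Q :=
        ENNReal.tsum_iUnion_le φ _
    _ ≤ ∑ _a : Fin n → Fin 3, Z := Finset.sum_le_sum fun a _ => hgrid a
    _ = 3 ^ n * Z := by simp

end Sparse

/-! ### Weighted norms by duality with test functions -/

theorem weightMeasure_ac {n : ℕ} {μ : Measure (Rn n)} {w : Rn n → ℝ} (hw : IsWeight w) :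
    μ ≪ weightMeasure μ w :=
  withDensity_absolutelyContinuous' hw.measurable.ennreal_ofReal.aemeasurable
    (Filter.Eventually.of_forall hw.ofReal_ne_zero)

theorem lintegral_le_of_dual {n : ℕ} {𝕜 : Type*} [RCLike 𝕜] {μ : Measure (Rn n)} [SigmaFinite μ]
    {w : Rn n → ℝ} (hw : IsWeight w) {P q : ℝ} (hPq : P.HolderConjugate q)
    {D : Submodule 𝕜 (Rn n → 𝕜)}
    (hsep : ∀ u : Rn n → 𝕜, AEStronglyMeasurable u μ →
      (∀ g ∈ D, Integrable (fun x => u x * g x) μ ∧ ∫ x, u x * g x ∂μ = 0) → ∀ᵐ x ∂μ, u x = 0)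
    (hmem : ∀ g ∈ D, MemLp g (ENNReal.ofReal q) (weightMeasure μ fun x => w x ^ (1 - q)))
    {u : Rn n → 𝕜} (hu : AEStronglyMeasurable u μ)
    (hint : ∀ g ∈ D, Integrable (fun x => u x * g x) μ) {K : ℝ≥0∞} (hK : K ≠ ∞)
    (hle : ∀ g ∈ D, ‖∫ x, u x * g x ∂μ‖ₑ ≤
      K * (∫⁻ x, ‖g x‖ₑ ^ q ∂weightMeasure μ fun x => w x ^ (1 - q)) ^ (1 / q)) :
    (∫⁻ x, ‖u x‖ₑ ^ P ∂weightMeasure μ w) ^ (1 / P) ≤ K := by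
  have hP := hPq.pos
  have hq := hPq.symm.pos
  have hσw : IsWeight fun x => w x ^ (1 - q) := hw.rpow _
  set σ : Rn n → ℝ := fun x => w x ^ (1 - q) with hσ
  have : Fact (1 ≤ ENNReal.ofReal q) := ⟨by
    rw [← ENNReal.ofReal_one]; exact ENNReal.ofReal_le_ofReal hPq.symm.lt.le⟩
  -- a finite measure equivalent to `μ`
  obtain ⟨G, hG0, hGm, hGi⟩ := exists_pos_lintegral_lt_of_sigmaFinite μ (one_ne_zero (α := ℝ≥0∞))
  set ω : Measure (Rn n) := μ.withDensity fun x => (G x : ℝ≥0∞) with hω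
  have hωf : IsFiniteMeasure ω := isFiniteMeasure_withDensity (hGi.trans ENNReal.one_lt_top).ne
  have hGe : Measurable fun x => (G x : ℝ≥0∞) := hGm.coe_nnreal_ennreal
  have hG0' : ∀ x, (0 : ℝ) < G x := hG0
  have hωμ : ω ≪ μ := withDensity_absolutelyContinuous _ _
  have hωl : ∀ φ : Rn n → ℝ≥0∞, ∫⁻ x, φ x ∂ω = ∫⁻ x, (G x : ℝ≥0∞) * φ x ∂μ := fun φ =>
    lintegral_withDensity_eq_lintegral_mul_non_measurable _ hGe
      (Filter.Eventually.of_forall fun _ => ENNReal.coe_lt_top) _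
  set ρ : Rn n → ℝ := fun x => (σ x / G x) ^ (1 / q) with hρ
  have hρ0 : ∀ x, 0 < ρ x := fun x => Real.rpow_pos_of_pos (div_pos (hσw.pos x) (hG0' x)) _
  have hρm : Measurable ρ := (hσw.measurable.div hGm.coe_nnreal_real).pow_const _
  have hGρ : ∀ x, (G x : ℝ) * ρ x ^ q = σ x := fun x => by
    rw [hρ]
    simp only
    rw [← Real.rpow_mul (div_pos (hσw.pos x) (hG0' x)).le, one_div_mul_cancel hq.ne', Real.rpow_one,
      mul_div_cancel₀ _ (hG0' x).ne']
  have hwρ : ∀ x, w x * (G x * ρ x) ^ P = G x := fun x => by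
    have hwx := hw.pos x
    have hgx := hG0' x
    have h1 : P * (1 / q) = P - 1 := by
      rw [← hPq.div_conj_eq_sub_one]
      ring
    have h2 : (1 - q) * (P - 1) = -1 := by have := hPq.mul_eq_add; linarith
    rw [hρ, hσ]
    simp only
    rw [Real.mul_rpow hgx.le (by positivity), ← Real.rpow_mul (by positivity), mul_comm (1 / q) P, h1,
      Real.div_rpow (by positivity) hgx.le, ← Real.rpow_mul hwx.le, h2, Real.rpow_neg_one,
      Real.rpow_sub_one hgx.ne']
    field_simp
  have henorm : ∀ (g : Rn n → 𝕜) (x : Rn n),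
      ‖(ρ x : 𝕜) * g x‖ₑ = ENNReal.ofReal (ρ x) * ‖g x‖ₑ := fun g x => by
    rw [enorm_mul, ← ofReal_norm (ρ x : 𝕜), RCLike.norm_ofReal, abs_of_pos (hρ0 x)]
  have hnormq : ∀ g : Rn n → 𝕜,
      ∫⁻ x, ‖(ρ x : 𝕜) * g x‖ₑ ^ q ∂ω = ∫⁻ x, ‖g x‖ₑ ^ q ∂weightMeasure μ σ := fun g => by
    rw [hωl, lintegral_weightMeasure μ hσw]
    refine lintegral_congr fun x => ?_
    rw [henorm, ENNReal.mul_rpow_of_nonneg _ _ hq.le, ← mul_assoc,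
      ENNReal.ofReal_rpow_of_pos (hρ0 x), ← ENNReal.ofReal_coe_nnreal,
      ← ENNReal.ofReal_mul (hG0' x).le, hGρ]
  have hqr : (ENNReal.ofReal q).toReal = q := ENNReal.toReal_ofReal hq.le
  have hq0 : ENNReal.ofReal q ≠ 0 := by simpa using hq
  have heL : ∀ g : Rn n → 𝕜, eLpNorm (fun x => (ρ x : 𝕜) * g x) (ENNReal.ofReal q) ω =
      (∫⁻ x, ‖g x‖ₑ ^ q ∂weightMeasure μ σ) ^ (1 / q) := fun g => by
    rw [eLpNorm_eq_lintegral_rpow_enorm_toReal hq0 ENNReal.ofReal_ne_top, hqr, hnormq]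
  have hρ𝕜 : AEStronglyMeasurable (fun x => (ρ x : 𝕜)) ω :=
    (RCLike.measurable_ofReal.comp hρm).aestronglyMeasurable
  have hJmem : ∀ g : D, MemLp (fun x => (ρ x : 𝕜) * (g : Rn n → 𝕜) x) (ENNReal.ofReal q) ω := by
    intro g
    have hg := hmem g g.2
    refine ⟨hρ𝕜.mul ((hg.1.mono_ac (weightMeasure_ac hσw)).mono_ac hωμ), ?_⟩
    rw [heL]
    have := hg.2
    rwa [eLpNorm_eq_lintegral_rpow_enorm_toReal hq0 ENNReal.ofReal_ne_top, hqr] at this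
  let J : D →ₗ[𝕜] Lp 𝕜 (ENNReal.ofReal q) ω :=
    { toFun := fun g => (hJmem g).toLp _
      map_add' := fun g h => by
        rw [← MemLp.toLp_add]
        exact MemLp.toLp_congr _ _ (Filter.Eventually.of_forall fun x => by simp [mul_add])
      map_smul' := fun c g => by
        rw [RingHom.id_apply, ← MemLp.toLp_const_smul]
        exact MemLp.toLp_congr _ _ (Filter.Eventually.of_forall fun x => by simp [mul_left_comm]) }
  let L : D →ₗ[𝕜] 𝕜 :=
    { toFun := fun g => ∫ x, u x * (g : Rn n → 𝕜) x ∂μ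
      map_add' := fun g h => by
        rw [← integral_add (hint g g.2) (hint h h.2)]
        simp [mul_add]
      map_smul' := fun c g => by
        rw [RingHom.id_apply, ← integral_smul]
        simp [mul_left_comm] }
  have hL : ∀ g, ‖L g‖ ≤ K.toReal * ‖J g‖ := fun g => by
    have h1 : ‖L g‖ₑ ≤ K * ‖J g‖ₑ := by
      refine (hle g g.2).trans (le_of_eq ?_)
      rw [← heL]
      exact congrArg (K * ·) (Lp.enorm_toLp (hf := hJmem g)).symm
    have h2 := ENNReal.toReal_mono (ENNReal.mul_ne_top hK enorm_ne_top) h1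
    rwa [ENNReal.toReal_mul, toReal_enorm, toReal_enorm] at h2
  obtain ⟨k, hkm, hkP, hkL⟩ := exists_representation hPq J L K.toReal ENNReal.toReal_nonneg hL
  set u' : Rn n → 𝕜 := fun x => ((G x : ℝ) : 𝕜) * (k x * (ρ x : 𝕜)) with hu'
  have hJae : ∀ g : D, (fun x => k x * J g x) =ᵐ[ω]
      fun x => k x * ((ρ x : 𝕜) * (g : Rn n → 𝕜) x) := fun g =>
    (MemLp.coeFn_toLp (hJmem g)).mono fun x hx => congrArg (k x * ·) hx
  have hsmul : ∀ (g : Rn n → 𝕜) x, G x • (k x * ((ρ x : 𝕜) * g x)) = u' x * g x := fun g x => by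
    rw [NNReal.smul_def, RCLike.real_smul_eq_coe_mul, hu']
    ring
  have hu'g : ∀ g ∈ D, Integrable (fun x => u' x * g x) μ ∧
      ∫ x, u' x * g x ∂μ = ∫ x, u x * g x ∂μ := by
    intro g hg
    obtain ⟨hi, he⟩ := hkL ⟨g, hg⟩
    rw [integrable_congr (hJae ⟨g, hg⟩), hω, integrable_withDensity_iff_integrable_smul hGm] at hi
    rw [integral_congr_ae (hJae ⟨g, hg⟩), hω, integral_withDensity_eq_integral_smul hGm] at he
    simp only [hsmul] at hi he
    exact ⟨hi, he.symm⟩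
  have hu'm : AEStronglyMeasurable u' μ := by
    have : Measurable u' := by
      have h1 : Measurable fun x => ((G x : ℝ) : 𝕜) :=
        RCLike.measurable_ofReal.comp hGm.coe_nnreal_real
      have h2 : Measurable fun x => (ρ x : 𝕜) := RCLike.measurable_ofReal.comp hρm
      exact h1.mul (hkm.mul h2)
    exact this.aestronglyMeasurable
  have hzero := hsep (fun x => u x - u' x) (hu.sub hu'm) fun g hg => by
    obtain ⟨h1, h2⟩ := hu'g g hg
    simp only [sub_mul]
    exact ⟨(hint g hg).sub h1, by rw [integral_sub (hint g hg) h1, h2, sub_self]⟩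
  have hnormP : ∫⁻ x, ‖u x‖ₑ ^ P ∂weightMeasure μ w = ∫⁻ x, ‖k x‖ₑ ^ P ∂ω := by
    rw [hωl, lintegral_weightMeasure μ hw]
    refine lintegral_congr_ae (hzero.mono fun x hx => ?_)
    simp only
    rw [sub_eq_zero.1 hx]
    have e : ‖u' x‖ₑ = ENNReal.ofReal (G x * ρ x) * ‖k x‖ₑ := by
      rw [← ofReal_norm (u' x), ← ofReal_norm (k x), ← ENNReal.ofReal_mul
        (mul_pos (hG0' x) (hρ0 x)).le, hu']
      simp only [norm_mul, RCLike.norm_ofReal, abs_of_pos (hG0' x), abs_of_pos (hρ0 x)]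
      ring_nf
    rw [e, ENNReal.mul_rpow_of_nonneg _ _ hP.le, ← mul_assoc,
      ENNReal.ofReal_rpow_of_pos (mul_pos (hG0' x) (hρ0 x)), ← ENNReal.ofReal_mul (hw.pos x).le, hwρ,
      ENNReal.ofReal_coe_nnreal]
  rw [hnormP]
  calc (∫⁻ x, ‖k x‖ₑ ^ P ∂ω) ^ (1 / P) ≤ (ENNReal.ofReal K.toReal ^ P) ^ (1 / P) := by gcongr
    _ = K := by
      rw [ENNReal.ofReal_toReal hK, ← ENNReal.rpow_mul, mul_one_div_cancel hP.ne', ENNReal.rpow_one]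

/-! ### Exponents -/

theorem conjExponent_eq_ofReal {x : ℝ≥0∞} (h1 : 1 < x) (hx : x ≠ ∞) :
    x.conjExponent = ENNReal.ofReal (x.toReal / (x.toReal - 1)) := by
  have h : 1 < x.toReal := by
    rw [← ENNReal.toReal_one]; exact (ENNReal.toReal_lt_toReal ENNReal.one_ne_top hx).2 h1
  have h0 : 0 < x.toReal - 1 := by linarith
  rw [ENNReal.conjExponent, show x.toReal / (x.toReal - 1) = 1 + (x.toReal - 1)⁻¹ by
    field_simp; ring, ENNReal.ofReal_add zero_le_one (by positivity), ENNReal.ofReal_one,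
    ENNReal.ofReal_inv_of_pos h0, ENNReal.ofReal_sub _ zero_le_one, ENNReal.ofReal_one,
    ENNReal.ofReal_toReal hx]

theorem one_le_conjExponent (x : ℝ≥0∞) : 1 ≤ x.conjExponent := le_self_add

theorem toReal_conjExponent {x : ℝ≥0∞} (h1 : 1 < x) (hx : x ≠ ∞) :
    x.conjExponent.toReal = x.toReal / (x.toReal - 1) := by
  have h : 1 < x.toReal := by
    rw [← ENNReal.toReal_one]; exact (ENNReal.toReal_lt_toReal ENNReal.one_ne_top hx).2 h1
  rw [conjExponent_eq_ofReal h1 hx, ENNReal.toReal_ofReal]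
  exact div_nonneg (by linarith) (by linarith)

theorem conjExponent_top : (∞ : ℝ≥0∞).conjExponent = 1 := by
  simp [ENNReal.conjExponent]

theorem conjExponent_ne_top {x : ℝ≥0∞} (h1 : 1 < x) : x.conjExponent ≠ ∞ := by
  rcases eq_or_ne x ∞ with rfl | hx
  · rw [conjExponent_top]; exact ENNReal.one_ne_top
  · rw [conjExponent_eq_ofReal h1 hx]; exact ENNReal.ofReal_ne_top

/-- The relations between the exponents of the theorem. -/
structure ExponentRelations (p₀ p q₀ : ℝ≥0∞) : Prop where
  p₀_ne_top : p₀ ≠ ∞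
  p_ne_top : p ≠ ∞
  one_le_p₀ : 1 ≤ p₀.toReal
  p₀_lt_p : p₀.toReal < p.toReal
  conj : p.toReal.HolderConjugate p.conjExponent.toReal
  one_le_b : 1 ≤ q₀.conjExponent.toReal
  b_lt_q : q₀.conjExponent.toReal < p.conjExponent.toReal
  s_ne_top : (q₀ / p).conjExponent ≠ ∞
  one_le_s : 1 ≤ (q₀ / p).conjExponent.toReal
  s_eq : 1 / ((q₀ / p).conjExponent.toReal * p.toReal) =
    1 / q₀.conjExponent.toReal - 1 / p.conjExponent.toReal
  final_eq : finalExponent p q₀ = (q₀ / p).conjExponent.toReal * (1 / q₀.conjExponent.toReal)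

theorem exponentRelations {p₀ p q₀ : ℝ≥0∞} (h1 : 1 ≤ p₀) (h2 : p₀ < p) (h3 : p < q₀) :
    ExponentRelations p₀ p q₀ := by
  have hp : p ≠ ∞ := h3.ne_top
  have hp₀ : p₀ ≠ ∞ := h2.ne_top
  have h1p : 1 < p := h1.trans_lt h2
  have h1q : 1 < q₀ := h1p.trans h3
  have hP : 1 < p.toReal := by
    rw [← ENNReal.toReal_one]; exact (ENNReal.toReal_lt_toReal ENNReal.one_ne_top hp).2 h1p
  have hr1 : 1 < q₀ / p := by
    rw [ENNReal.lt_div_iff_mul_lt (Or.inl (one_pos.trans h1p).ne') (Or.inl hp), one_mul]; exact h3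
  have hs := conjExponent_ne_top hr1
  have hge : ∀ {x : ℝ≥0∞}, x.conjExponent ≠ ∞ → 1 ≤ x.conjExponent.toReal := fun {x} hx => by
    rw [← ENNReal.toReal_one]; exact ENNReal.toReal_mono hx (one_le_conjExponent x)
  have hq : p.conjExponent.toReal = p.toReal / (p.toReal - 1) := toReal_conjExponent h1p hp
  have key : q₀.conjExponent.toReal < p.conjExponent.toReal ∧
      1 / ((q₀ / p).conjExponent.toReal * p.toReal) =
        1 / q₀.conjExponent.toReal - 1 / p.conjExponent.toReal ∧
      finalExponent p q₀ = (q₀ / p).conjExponent.toReal * (1 / q₀.conjExponent.toReal) := by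
    have hP1 : 0 < p.toReal - 1 := by linarith
    rcases eq_or_ne q₀ ∞ with rfl | hq₀
    · rw [ENNReal.top_div_of_ne_top hp, conjExponent_top, hq, finalExponent, if_pos rfl,
        ENNReal.toReal_one]
      refine ⟨?_, ?_, by norm_num⟩
      · rw [lt_div_iff₀ hP1]; linarith
      · field_simp; ring
    · have hPQ : p.toReal < q₀.toReal := (ENNReal.toReal_lt_toReal hp hq₀).2 h3
      have hpos : 0 < p.toReal := by linarith
      have hdiv : q₀ / p ≠ ∞ := ENNReal.div_ne_top hq₀ (one_pos.trans h1p).ne'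
      rw [toReal_conjExponent hr1 hdiv, ENNReal.toReal_div, toReal_conjExponent h1q hq₀, hq,
        finalExponent, if_neg hq₀]
      have e1 : 0 < q₀.toReal - 1 := by linarith
      have e2 : 0 < q₀.toReal - p.toReal := by linarith
      have e3 : q₀.toReal / p.toReal - 1 = (q₀.toReal - p.toReal) / p.toReal := by field_simp
      have e4 : 0 < q₀.toReal := by linarith
      rw [e3]
      refine ⟨?_, ?_, ?_⟩
      · rw [div_lt_div_iff₀ e1 hP1]; nlinarith
      · field_simp; ring
      · field_simp
  refine ⟨hp₀, hp, ?_, (ENNReal.toReal_lt_toReal hp₀ hp).2 h2, ?_, hge (conjExponent_ne_top h1q),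
    key.1, hs, hge hs, key.2.1, key.2.2⟩
  · rw [← ENNReal.toReal_one]; exact ENNReal.toReal_mono hp₀ h1
  · rw [hq]; exact Real.HolderConjugate.conjExponent hP

theorem rpow_le_self {K : ℝ≥0∞} (hK : 1 ≤ K) {r : ℝ} (hr : r ≤ 1) : K ^ r ≤ K := by
  calc K ^ r ≤ K ^ (1 : ℝ) := ENNReal.rpow_le_rpow_of_exponent_le hK hr
    _ = K := ENNReal.rpow_one K

theorem embConst_rpow_le {b q : ℝ} (hb : 1 ≤ b) (hq : b < q) :
    embConst (q / b) ^ (1 / q) ≤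
      2 * ENNReal.ofReal (q / b / (q / b - 1)) ^ (1 / b) := by
  have hb0 : 0 < b := by linarith
  have hq0 : 0 < q := by linarith
  have ht : 1 < q / b := (one_lt_div hb0).2 hq
  have ht1 : 0 < q / b - 1 := by linarith
  have hconj : 1 ≤ q / b / (q / b - 1) := by rw [le_div_iff₀ ht1]; linarith
  rw [embConst, ENNReal.ofReal_mul (by positivity), ENNReal.mul_rpow_of_nonneg _ _ (by positivity)]
  refine mul_le_mul' ?_ ?_
  · rw [← ENNReal.ofReal_rpow_of_pos two_pos, ← ENNReal.rpow_mul,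
      show q / b * (1 / q) = 1 / b by field_simp, ENNReal.ofReal_ofNat]
    exact rpow_le_self (by norm_num) ((div_le_one hb0).2 hb)
  · refine ENNReal.rpow_le_rpow_of_exponent_le ?_ (one_div_le_one_div_of_le hb0 hq.le)
    rw [← ENNReal.ofReal_one]; exact ENNReal.ofReal_le_ofReal hconj

theorem embConst_mul_le_cConst {p₀ p q₀ : ℝ≥0∞} (h : ExponentRelations p₀ p q₀) :
    embConst (p.toReal / p₀.toReal) ^ (1 / p.toReal) *
      embConst (p.conjExponent.toReal / q₀.conjExponent.toReal) ^ (1 / p.conjExponent.toReal) ≤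
      4 * cConst p₀ p q₀ := by
  have hp₀ : 0 < p₀.toReal := by linarith [h.one_le_p₀]
  have hb : 0 < q₀.conjExponent.toReal := by linarith [h.one_le_b]
  have hbt : q₀.conjExponent ≠ ∞ := fun h' => by simp [h'] at hb
  have hq : 0 < p.conjExponent.toReal := h.conj.symm.pos
  have hqt : p.conjExponent ≠ ∞ := fun h' => by simp [h'] at hq
  have hb0 : q₀.conjExponent ≠ 0 := fun h' => by simp [h'] at hb
  have hp₀0 : p₀ ≠ 0 := fun h' => by simp [h'] at hp₀
  have e1 : (p / p₀).conjExponent =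
      ENNReal.ofReal (p.toReal / p₀.toReal / (p.toReal / p₀.toReal - 1)) := by
    rw [conjExponent_eq_ofReal _ (ENNReal.div_ne_top h.p_ne_top hp₀0), ENNReal.toReal_div]
    rw [ENNReal.lt_div_iff_mul_lt (Or.inl hp₀0) (Or.inl h.p₀_ne_top), one_mul]
    exact (ENNReal.toReal_lt_toReal h.p₀_ne_top h.p_ne_top).1 h.p₀_lt_p
  have e2 : (p.conjExponent / q₀.conjExponent).conjExponent =
      ENNReal.ofReal (p.conjExponent.toReal / q₀.conjExponent.toReal /
        (p.conjExponent.toReal / q₀.conjExponent.toReal - 1)) := by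
    rw [conjExponent_eq_ofReal _ (ENNReal.div_ne_top hqt hb0), ENNReal.toReal_div]
    rw [ENNReal.lt_div_iff_mul_lt (Or.inl hb0) (Or.inl hbt), one_mul]
    exact (ENNReal.toReal_lt_toReal hbt hqt).1 h.b_lt_q
  rw [cConst, e2]
  calc _ ≤ (2 * ENNReal.ofReal (p.toReal / p₀.toReal / (p.toReal / p₀.toReal - 1)) ^
          (1 / p₀.toReal)) * (2 * ENNReal.ofReal (p.conjExponent.toReal / q₀.conjExponent.toReal /
        (p.conjExponent.toReal / q₀.conjExponent.toReal - 1)) ^ (1 / q₀.conjExponent.toReal)) :=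
        mul_le_mul' (embConst_rpow_le h.one_le_p₀ h.p₀_lt_p) (embConst_rpow_le h.one_le_b h.b_lt_q)
    _ ≤ (2 * ((p₀.conjExponent / p.conjExponent).conjExponent * (p / p₀).conjExponent) ^
          (1 / p₀.toReal)) * (2 * ENNReal.ofReal (p.conjExponent.toReal / q₀.conjExponent.toReal /
        (p.conjExponent.toReal / q₀.conjExponent.toReal - 1)) ^ (1 / q₀.conjExponent.toReal)) := by
        rw [← e1]
        gcongr
        exact le_mul_of_one_le_left' (one_le_conjExponent _)
    _ = _ := by rw [show (4 : ℝ≥0∞) = 2 * 2 by norm_num]; ring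

/-! ### The operator norm -/

/-- The constant in the theorem. -/
noncomputable def mainConst (n : ℕ) (cT η : ℝ) (K : ℝ≥0∞) : ℝ≥0∞ :=
  4 * ENNReal.ofReal cT * 3 ^ n * K ^ 3 * ENNReal.ofReal η⁻¹

theorem sparse_constant_le {n : ℕ} {p₀ p q₀ : ℝ≥0∞} (h : ExponentRelations p₀ p q₀) {K : ℝ≥0∞}
    (hK : 1 ≤ K) {cT η : ℝ} (hη : 0 < η) (A B X Y : ℝ≥0∞) :
    ENNReal.ofReal cT * (3 ^ n * (((K * K * A) ^ (1 / (q₀ / p).conjExponent.toReal) *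
        (ENNReal.ofReal η⁻¹ * (embConst (p.toReal / p₀.toReal) * X))) ^ (1 / p.toReal) *
      (K * ENNReal.ofReal η⁻¹ * B *
        (embConst (p.conjExponent.toReal / q₀.conjExponent.toReal) * Y)) ^
          (1 / p.conjExponent.toReal))) ≤
      mainConst n cT η K * cConst p₀ p q₀ * B ^ (1 / p.conjExponent.toReal) *
        A ^ (1 / (p.toReal * (q₀ / p).conjExponent.toReal)) * X ^ (1 / p.toReal) *
          Y ^ (1 / p.conjExponent.toReal) := by
  have hemb := embConst_mul_le_cConst h
  have hP := h.conj.pos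
  have hq := h.conj.symm.pos
  have hs : 0 < (q₀ / p).conjExponent.toReal := by linarith [h.one_le_s]
  have hsum : 1 / p.toReal + 1 / p.conjExponent.toReal = 1 := by
    rw [one_div, one_div]; exact h.conj.inv_add_inv_eq_one
  set P := p.toReal
  set q := p.conjExponent.toReal
  set s := (q₀ / p).conjExponent.toReal
  set e := ENNReal.ofReal η⁻¹ with he
  set E₁ := embConst (P / p₀.toReal)
  set E₂ := embConst (q / q₀.conjExponent.toReal)
  have he0 : e ≠ 0 := by simpa [he] using hη
  have hPs : (1 / s) * (1 / P) = 1 / (P * s) := by field_simp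
  have hPs1 : 1 / (P * s) ≤ 1 := by
    rw [div_le_one (by positivity)]; nlinarith [h.one_le_s, h.conj.lt]
  have hq1 : 1 / q ≤ 1 := by rw [div_le_one hq]; exact h.conj.symm.lt.le
  calc _ = ENNReal.ofReal cT * 3 ^ n * (K ^ (1 / (P * s)) * K ^ (1 / (P * s)) * K ^ (1 / q)) *
        (e ^ (1 / P) * e ^ (1 / q)) * (E₁ ^ (1 / P) * E₂ ^ (1 / q)) * B ^ (1 / q) *
        A ^ (1 / (P * s)) * X ^ (1 / P) * Y ^ (1 / q) := by
        have h1 : 0 ≤ 1 / P := by positivity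
        have h2 : 0 ≤ 1 / q := by positivity
        have h3 : 0 ≤ 1 / s := by positivity
        simp only [ENNReal.mul_rpow_of_nonneg _ _ h1, ENNReal.mul_rpow_of_nonneg _ _ h2,
          ENNReal.mul_rpow_of_nonneg _ _ h3, ← ENNReal.rpow_mul, hPs]
        ring
    _ ≤ ENNReal.ofReal cT * 3 ^ n * (K * K * K) * e * (4 * cConst p₀ p q₀) * B ^ (1 / q) *
        A ^ (1 / (P * s)) * X ^ (1 / P) * Y ^ (1 / q) := by
        rw [← ENNReal.rpow_add _ _ he0 ENNReal.ofReal_ne_top, hsum, ENNReal.rpow_one]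
        gcongr
        · exact rpow_le_self hK hPs1
        · exact rpow_le_self hK hPs1
        · exact rpow_le_self hK hq1
    _ = _ := by rw [mainConst]; ring

theorem weightedOpNorm_le {n : ℕ} {𝕜 : Type*} [RCLike 𝕜] {μ : Measure (Rn n)}
    (hμ : IsDoubling μ) {K : ℝ≥0∞} (hK : Comparison μ K) {D : Submodule 𝕜 (Rn n → 𝕜)}
    (hD : IsTestSpace μ D) {p₀ p q₀ : ℝ≥0∞} (h : ExponentRelations p₀ p q₀) {cT η : ℝ}
    (hη : 0 < η)
    {T : (Rn n → 𝕜) → (Rn n → 𝕜)} (hT : IsSparselyDominated μ D p₀ q₀ cT η T) {w : Rn n → ℝ}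
    (hw : IsA1 μ w) (hA : A1Const μ (fun x => w x ^ (q₀ / p).conjExponent.toReal) ≠ ∞) :
    weightedOpNorm μ D p w T ≤ mainConst n cT η K * cConst p₀ p q₀ *
      AInftyConst μ (fun x => w x ^ (q₀ / p).conjExponent.toReal) ^ (1 / p.conjExponent.toReal) *
      A1Const μ (fun x => w x ^ (q₀ / p).conjExponent.toReal) ^
        (1 / (p.toReal * (q₀ / p).conjExponent.toReal)) := by
  have := hμ.isLocallyFiniteMeasure
  have hconj := h.conj
  have hP := hconj.pos
  have hq := hconj.symm.pos
  have hb : 0 < q₀.conjExponent.toReal := by linarith [h.one_le_b]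
  have hp₀ : 0 < p₀.toReal := by linarith [h.one_le_p₀]
  have hs : 0 < (q₀ / p).conjExponent.toReal := by linarith [h.one_le_s]
  have hbt : q₀.conjExponent ≠ ∞ := fun h' => by simp [h'] at hb
  have hb0 : q₀.conjExponent ≠ 0 := fun h' => by simp [h'] at hb
  have hp₀0 : p₀ ≠ 0 := fun h' => by simp [h'] at hp₀
  have hp0 : p ≠ 0 := fun h' => by simp [h'] at hP
  set s := (q₀ / p).conjExponent.toReal with hsdef
  set v : Rn n → ℝ := fun x => w x ^ s with hv
  set C := mainConst n cT η K * cConst p₀ p q₀ * AInftyConst μ v ^ (1 / p.conjExponent.toReal) *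
    A1Const μ v ^ (1 / (p.toReal * s)) with hC
  have hσ := hw.dual_isAInfty hμ hK hconj
  have hmem : ∀ g ∈ D, MemLp g (ENNReal.ofReal p.conjExponent.toReal)
      (weightMeasure μ fun x => w x ^ (1 - p.conjExponent.toReal)) :=
    hD.memLp _ _ (by rw [← ENNReal.ofReal_one]; exact ENNReal.ofReal_le_ofReal hconj.symm.lt.le)
      ENNReal.ofReal_lt_top hσ
  have hae : ∀ g ∈ D, AEMeasurable (fun x => ‖g x‖ₑ) μ := fun g hg =>
    ((hmem g hg).1.mono_ac (weightMeasure_ac hσ.weight)).enorm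
  refine sInf_le fun f hf => ?_
  rw [eLpNorm_eq_lintegral_rpow_enorm_toReal hp0 h.p_ne_top,
    eLpNorm_eq_lintegral_rpow_enorm_toReal hp0 h.p_ne_top]
  rcases eq_or_ne (C * (∫⁻ x, ‖f x‖ₑ ^ p.toReal ∂weightMeasure μ w) ^ (1 / p.toReal)) ∞ with ht | ht
  · rw [ht]; exact le_top
  refine lintegral_le_of_dual hw.weight hconj hD.separating hmem (hT.aestronglyMeasurable f hf)
    (hT.integrable_pairing f hf) ht fun g hg => ?_
  obtain ⟨S, hS, hle⟩ := hT.domination f hf g hg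
  refine hle.trans ?_
  simp only [avg_eq μ _ hp₀0 h.p₀_ne_top, avg_eq μ _ hb0 hbt]
  refine (mul_le_mul_right (tsum_sparse_le hμ hK hS hw.weight hs hA hp₀ h.p₀_lt_p hb h.b_lt_q hconj
    h.s_eq (hae f hf) (hae g hg)) _).trans ?_
  exact sparse_constant_le h hK.one_le hη _ _ _ _

theorem mainConst_ne_top (n : ℕ) (cT η : ℝ) {K : ℝ≥0∞} (hK : K ≠ ∞) : mainConst n cT η K ≠ ∞ := by
  unfold mainConst
  finiteness

theorem mainConst_ne_zero (n : ℕ) {cT η : ℝ} (hcT : 0 < cT) (hη : 0 < η) {K : ℝ≥0∞} (hK : 1 ≤ K) :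
    mainConst n cT η K ≠ 0 := by
  have : K ≠ 0 := (one_pos.trans_le hK).ne'
  simp [mainConst, hcT, hη, this]

end SparseWeights

theorem theorem1p1 {𝕜 : Type*} [RCLike 𝕜] (n : ℕ) (hn : 0 < n) (ν cT η : ℝ)
    (hcT : 0 < cT) (hη : 0 < η) (hη' : η ≤ 1) :
    ∃ c : ℝ, 0 < c ∧
      ∀ μ : Measure (SparseWeights.Rn n),
        SparseWeights.IsDoubling μ → SparseWeights.doublingDim μ = ν →
      ∀ D : Submodule 𝕜 (SparseWeights.Rn n → 𝕜), SparseWeights.IsTestSpace μ D →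
      ∀ p₀ p q₀ : ℝ≥0∞, 1 ≤ p₀ → p₀ < p → p < q₀ →
      ∀ T : (SparseWeights.Rn n → 𝕜) → (SparseWeights.Rn n → 𝕜),
        SparseWeights.IsSparselyDominated μ D p₀ q₀ cT η T →
      ∀ w : SparseWeights.Rn n → ℝ,
        SparseWeights.IsA1 μ w → SparseWeights.IsRH μ (q₀ / p).conjExponent w →
      ∀ (s : ℝ) (v : SparseWeights.Rn n → ℝ),
        s = (q₀ / p).conjExponent.toReal → v = (fun x => w x ^ s) →
        SparseWeights.weightedOpNorm μ D p w T ≤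
            ENNReal.ofReal c * SparseWeights.cConst p₀ p q₀ *
              SparseWeights.AInftyConst μ v ^ (1 / p.conjExponent.toReal) *
              SparseWeights.A1Const μ v ^ (1 / (p.toReal * s)) ∧
        SparseWeights.weightedOpNorm μ D p w T ≤
            ENNReal.ofReal c * SparseWeights.cConst p₀ p q₀ *
              SparseWeights.A1Const μ v ^ (1 / q₀.conjExponent.toReal) ∧
        SparseWeights.cConst p₀ p q₀ *
            SparseWeights.A1Const μ v ^ (1 / q₀.conjExponent.toReal) ≤
          SparseWeights.cConst p₀ p q₀ *
            (SparseWeights.A1Const μ w *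
              SparseWeights.RHConst μ (q₀ / p).conjExponent w) ^
                SparseWeights.finalExponent p q₀ := by
  open SparseWeights in
  obtain ⟨K₀, hK₀⟩ := exists_comparison hn ν
  by_cases hex : ∃ μ : Measure (Rn n), IsDoubling μ ∧ doublingDim μ = ν
  swap
  · exact ⟨1, one_pos, fun μ hμ hν => absurd ⟨μ, hμ, hν⟩ hex⟩
  obtain ⟨μ₀, hμ₀, hν₀⟩ := hex
  have hK1 := (hK₀ μ₀ hμ₀ hν₀).one_le
  have hKt := (hK₀ μ₀ hμ₀ hν₀).ne_top
  have hct : mainConst n cT η K₀ * K₀ ≠ ∞ := ENNReal.mul_ne_top (mainConst_ne_top n cT η hKt) hKt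
  have hc0 : mainConst n cT η K₀ * K₀ ≠ 0 :=
    mul_ne_zero (mainConst_ne_zero n hcT hη hK1) (one_pos.trans_le hK1).ne'
  refine ⟨(mainConst n cT η K₀ * K₀).toReal, ENNReal.toReal_pos hc0 hct, ?_⟩
  intro μ hμ hν D hD p₀ p q₀ h1 h2 h3 T hT w hw hRH s v hs hv
  have hK := hK₀ μ hμ hν
  have h := exponentRelations h1 h2 h3
  have := hμ.isLocallyFiniteMeasure
  have hb : 0 < q₀.conjExponent.toReal := by linarith [h.one_le_b]
  have hP := h.conj.pos
  have hq := h.conj.symm.pos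
  have hs0 : 0 < s := by rw [hs]; linarith [h.one_le_s]
  have hvw : IsWeight v := by rw [hv]; exact hw.weight.rpow s
  have hRHt : RHConst μ (q₀ / p).conjExponent w ≠ ∞ := by
    by_cases h' : (q₀ / p).conjExponent = 1
    · rw [RHConst, if_pos h']; exact ENNReal.one_ne_top
    · exact (hRH.2 h').2.2.ne
  have hAle : A1Const μ v ≤ (A1Const μ w * RHConst μ (q₀ / p).conjExponent w) ^ s := by
    rw [hv, hs]
    exact A1Const_rpow_le hμ hw (one_le_conjExponent _) h.s_ne_top
  have hA : A1Const μ v ≠ ∞ := (hAle.trans_lt (ENNReal.rpow_lt_top_of_nonneg hs0.le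
    (ENNReal.mul_ne_top hw.const_lt_top.ne hRHt))).ne
  have hmain : weightedOpNorm μ D p w T ≤ mainConst n cT η K₀ * cConst p₀ p q₀ *
      AInftyConst μ v ^ (1 / p.conjExponent.toReal) * A1Const μ v ^ (1 / (p.toReal * s)) := by
    rw [hv, hs]
    rw [hv, hs] at hA
    exact weightedOpNorm_le hμ hK hD h hη hT hw hA
  rw [ENNReal.ofReal_toReal hct]
  refine ⟨hmain.trans ?_, hmain.trans ?_, ?_⟩
  · gcongr
    exact le_mul_of_one_le_right' hK1
  · have hAI : AInftyConst μ v ^ (1 / p.conjExponent.toReal) ≤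
        K₀ * A1Const μ v ^ (1 / p.conjExponent.toReal) := by
      calc AInftyConst μ v ^ (1 / p.conjExponent.toReal)
          ≤ (K₀ * A1Const μ v) ^ (1 / p.conjExponent.toReal) := by
            gcongr; exact hvw.aInftyConst_le hμ hK
        _ = K₀ ^ (1 / p.conjExponent.toReal) * A1Const μ v ^ (1 / p.conjExponent.toReal) :=
            ENNReal.mul_rpow_of_nonneg _ _ (by positivity)
        _ ≤ _ := by
            gcongr
            exact rpow_le_self hK1 ((div_le_one hq).2 h.conj.symm.lt.le)
    have hexp : 1 / p.conjExponent.toReal + 1 / (p.toReal * s) = 1 / q₀.conjExponent.toReal := by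
      have := h.s_eq
      rw [← hs, mul_comm s] at this
      linarith
    calc mainConst n cT η K₀ * cConst p₀ p q₀ * AInftyConst μ v ^ (1 / p.conjExponent.toReal) *
          A1Const μ v ^ (1 / (p.toReal * s))
        ≤ mainConst n cT η K₀ * cConst p₀ p q₀ *
          (K₀ * A1Const μ v ^ (1 / p.conjExponent.toReal)) * A1Const μ v ^ (1 / (p.toReal * s)) := by
          gcongr
      _ = mainConst n cT η K₀ * K₀ * cConst p₀ p q₀ *
          (A1Const μ v ^ (1 / p.conjExponent.toReal) * A1Const μ v ^ (1 / (p.toReal * s))) := by ring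
      _ = _ := by
          rw [← ENNReal.rpow_add_of_nonneg _ _ (by positivity) (by positivity), hexp]
  · gcongr
    calc A1Const μ v ^ (1 / q₀.conjExponent.toReal)
        ≤ ((A1Const μ w * RHConst μ (q₀ / p).conjExponent w) ^ s) ^
            (1 / q₀.conjExponent.toReal) := by gcongr
      _ = _ := by rw [← ENNReal.rpow_mul, h.final_eq, hs]
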